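/- Let $\mathcal F=\bigoplus_{n\ge 0}L^2_{\mathsf a}(\mathbb R^{d\cdot n})$ be the fermionic Fock space over $L^2(\mathbb R^d)$, where $L^2_{\mathsf a}(\mathbb R^{d\cdot n})$ is the space of square integrable functions of $n$ variables in $\mathbb R^d$ that are antisymmetric under permutations of the variables. For $f\in L^2(\mathbb R^d)$ let $a(f)$ be the annihilation operator, $(a(f)\psi)^{(n)}(x)=\sqrt{n+1}\int\overline{f(k)}\,\psi^{(n+1)}(k,x)\,dk$, which is a bounded operator on $\mathcal F$, and let $a^\dagger(f)=a(f)^*$. Let $\mathcal A$ be the CAR algebra, i.e. the unital $C^*$-algebra generated by all $a(f)$, $f\in L^2(\mathbb R^d)$. Let $\mathfrak K\subseteq L^2(\mathbb R^d)$ be a closed subspace and let $(f_n)$ be a (finite or infinite) orthonormal basis of $\mathfrak K^\perp$. Put $$u_n^{(0)}=1,\quad u_n^{(1)}=a^\dagger(f_n)+a(f_n),\quad u_n^{(2)}=a^\dagger(f_n)-a(f_n),\quad u_n^{(3)}=1-2a^\dagger(f_n)a(f_n),$$ $u(\underline\alpha)=u_1^{(\alpha_1)}\cdots u_N^{(\alpha_N)}$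 for $\underline\alpha\in\{0,1,2,3\}^N$, and $$\mathbb E^N_{\mathfrak K}(A)=\frac1{4^N}\sum_{\underline\alpha\in\{0,1,2,3\}^N}u(\underline\alpha)^*A\,u(\underline\alpha),\qquad A\in\mathcal A,$$ where $\mathbb E^N_{\mathfrak K}=\mathbb E^M_{\mathfrak K}$ for $N\ge M$ if $\mathfrak K^\perp$ has finite dimension $M$. Let $\mathcal A_{\mathfrak K^\perp}$ be the unital $C^*$-subalgebra generated by all $a(f_n)$, and let $\mathcal A^+$ and $\mathcal A^+_{\mathfrak K}$ be the $C^*$-subalgebras generated by the products of an even number (possibly zero) of factors $a(g)$ or $a^\dagger(g)$ with $g\in L^2(\mathbb R^d)$ and $g\in\mathfrak K$, respectively. Let $(g_i)$ be any orthonormal basis of $L^2(\mathbb R^d)$. There is exactly one tracial state $\omega^{\mathrm{tr}}$ on $\mathcal A$ such that $$\omega^{\mathrm{tr}}\big(a^\dagger(g_{i_n})\cdots a^\dagger(g_{i_1})a(g_{i_1})\cdots a(g_{i_n})\big)=2^{-n}\quad\text{for distinct } i_1,\dots,i_n,$$ $$\omega^{\mathrm{tr}}\big(a^\dagger(g_{i_m})\cdots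 a^\dagger(g_{i_1})a(g_{j_1})\cdots a(g_{j_n})\big)=0\quad\text{for }\{i_1,\dots,i_m\}\neq\{j_1,\dots,j_n\}.$$ The limit $\mathbb E_{\mathfrak K}(A)=\lim_{N\to\infty}\mathbb E^N_{\mathfrak K}(A)$ exists in operator norm for every $A\in\mathcal A$ and defines a bounded linear map $\mathbb E_{\mathfrak K}:\mathcal A\to\mathcal A$ with the following properties: 1. $\|\mathbb E_{\mathfrak K}\|=1$; 2. $\mathbb E_{\mathfrak K}(A)=\omega^{\mathrm{tr}}(A)\,1$ for all $A\in\mathcal A_{\mathfrak K^\perp}$; 3. $\mathbb E_{\mathfrak K}\circ\mathbb E_{\mathfrak K}=\mathbb E_{\mathfrak K}$; 4. $\mathbb E_{\mathfrak K}(\mathcal A^+)=\mathcal A^+_{\mathfrak K}$. In particular, $\mathbb E_{\mathfrak K}$ restricts to a norm-one projection from $\mathcal A^+$ onto its $C^*$-subalgebra $\mathcal A^+_{\mathfrak K}$: the restriction has norm one and fixes every element of $\mathcal A^+_{\mathfrak K}$. -/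

import Mathlib

open MeasureTheory
open scoped InnerProductSpace

namespace FermiFock

theorem mp_cons (X : Type*) [MeasureSpace X] [SigmaFinite (volume : Measure X)] (n : ℕ) :
    MeasurePreserving (fun p : X × (Fin n → X) => (Fin.cons p.1 p.2 : Fin (n + 1) → X))
      volume volume := by
  have h := (volume_preserving_piFinSuccAbove (fun _ : Fin (n + 1) => X) 0).symm
  have e : (fun p : X × (Fin n → X) => (Fin.cons p.1 p.2 : Fin (n + 1) → X)) =
      (MeasurableEquiv.piFinSuccAbove (fun _ : Fin (n + 1) => X) 0).symm := by
    funext p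
    simp [MeasurableEquiv.piFinSuccAbove, Fin.insertNthEquiv]
  rw [e]; exact h

theorem mp_uncons (X : Type*) [MeasureSpace X] [SigmaFinite (volume : Measure X)] (n : ℕ) :
    MeasurePreserving (fun x : Fin (n + 1) → X => ((x 0, Fin.tail x) : X × (Fin n → X)))
      volume volume := by
  have h := volume_preserving_piFinSuccAbove (fun _ : Fin (n + 1) => X) 0
  have e : (fun x : Fin (n + 1) → X => ((x 0, Fin.tail x) : X × (Fin n → X))) =
      (MeasurableEquiv.piFinSuccAbove (fun _ : Fin (n + 1) => X) 0) := by
    funext p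
    simp [MeasurableEquiv.piFinSuccAbove, Fin.insertNthEquiv]
  rw [e]; exact h

theorem mp_perm (X : Type*) [MeasureSpace X] [SigmaFinite (volume : Measure X)] {n : ℕ}
    (σ : Equiv.Perm (Fin n)) :
    MeasurePreserving (fun x : Fin n → X => x ∘ σ) volume volume := by
  have h := volume_measurePreserving_piCongrLeft (fun _ : Fin n => X) σ.symm
  have e : (fun x : Fin n → X => x ∘ σ) =
      MeasurableEquiv.piCongrLeft (fun _ : Fin n => X) σ.symm := by
    funext x i
    have := Equiv.piCongrLeft_apply_apply (P := fun _ : Fin n => X) (e := σ.symm) x (σ i)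
    simp only [Equiv.symm_apply_apply] at this
    exact this.symm
  rw [e]; exact h

/-- The one-particle space `L²(X)`. -/
abbrev OneParticle (X : Type*) [MeasureSpace X] : Type _ := Lp ℂ 2 (volume : Measure X)

/-- Square integrable functions of `n` variables in `X`. -/
abbrev L2n (X : Type*) [MeasureSpace X] (n : ℕ) : Type _ :=
  Lp ℂ 2 (volume : Measure (Fin n → X))

/-- Permutation of the variables, `ψ ↦ ψ (x ∘ σ)`. -/
noncomputable def permOp (X : Type*) [MeasureSpace X] [SigmaFinite (volume : Measure X)] {n : ℕ}
    (σ : Equiv.Perm (Fin n)) : L2n X n →ₗᵢ[ℂ] L2n X n :=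
  Lp.compMeasurePreservingₗᵢ ℂ (fun x : Fin n → X => x ∘ σ) (mp_perm X σ)

theorem permOp_coe {X : Type*} [MeasureSpace X] [SigmaFinite (volume : Measure X)] {n : ℕ}
    (σ : Equiv.Perm (Fin n)) (ψ : L2n X n) :
    permOp X σ ψ =ᵐ[volume] fun x => ψ (x ∘ σ) :=
  Lp.coeFn_compMeasurePreserving ψ (mp_perm X σ)

theorem permOp_mul {X : Type*} [MeasureSpace X] [SigmaFinite (volume : Measure X)] {n : ℕ}
    (σ τ : Equiv.Perm (Fin n)) (ψ : L2n X n) :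
    permOp X σ (permOp X τ ψ) = permOp X (σ * τ) ψ := by
  apply Lp.ext
  filter_upwards [permOp_coe σ (permOp X τ ψ), permOp_coe (σ * τ) ψ,
    (mp_perm X σ).quasiMeasurePreserving.ae (permOp_coe τ ψ)] with x h1 h2 h3
  rw [h1, h2, h3]; rfl

theorem permOp_one {X : Type*} [MeasureSpace X] [SigmaFinite (volume : Measure X)] {n : ℕ}
    (ψ : L2n X n) : permOp X 1 ψ = ψ := by
  apply Lp.ext
  filter_upwards [permOp_coe 1 ψ] with x h1
  rw [h1]; rfl

theorem permOp_inner {X : Type*} [MeasureSpace X] [SigmaFinite (volume : Measure X)] {n : ℕ}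
    (σ : Equiv.Perm (Fin n)) (η ψ : L2n X n) :
    ⟪permOp X σ η, ψ⟫_ℂ = ⟪η, permOp X σ⁻¹ ψ⟫_ℂ := by
  rw [← (permOp X σ).inner_map_map η, permOp_mul, mul_inv_cancel, permOp_one]

theorem antisym_iff {X : Type*} [MeasureSpace X] [SigmaFinite (volume : Measure X)] {n : ℕ}
    (σ : Equiv.Perm (Fin n)) (ψ : L2n X n) :
    ((fun x => ψ (x ∘ σ)) =ᵐ[volume] fun x => ((Equiv.Perm.sign σ : ℤ) : ℂ) * ψ x) ↔
      permOp X σ ψ = ((Equiv.Perm.sign σ : ℤ) : ℂ) • ψ := by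
  have h2 := Lp.coeFn_smul ((Equiv.Perm.sign σ : ℤ) : ℂ) ψ
  constructor
  · intro h
    apply Lp.ext
    filter_upwards [permOp_coe σ ψ, h, h2] with x a b c
    rw [a, b, c]; rfl
  · intro h
    rw [← h] at h2
    filter_upwards [permOp_coe σ ψ, h2] with x a c
    rw [← a, c]; rfl

/-- The closed subspace `L²_a(Xⁿ)` of square integrable functions of `n` variables in `X` that are
antisymmetric under permutations of the variables. -/
noncomputable def antisymm (X : Type*) [MeasureSpace X] [SigmaFinite (volume : Measure X)]
    (n : ℕ) : Submodule ℂ (L2n X n) where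
  carrier := {ψ | ∀ σ : Equiv.Perm (Fin n),
    (fun x => ψ (x ∘ σ)) =ᵐ[volume] fun x => ((Equiv.Perm.sign σ : ℤ) : ℂ) * ψ x}
  add_mem' := by
    intro a b ha hb σ
    rw [antisym_iff, map_add, (antisym_iff σ a).1 (ha σ), (antisym_iff σ b).1 (hb σ), smul_add]
  zero_mem' := by
    intro σ
    rw [antisym_iff, map_zero, smul_zero]
  smul_mem' := by
    intro c a ha σ
    rw [antisym_iff, map_smul, (antisym_iff σ a).1 (ha σ), smul_comm]

theorem mem_antisymm {X : Type*} [MeasureSpace X] [SigmaFinite (volume : Measure X)] {n : ℕ}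
    {ψ : L2n X n} : ψ ∈ antisymm X n ↔
      ∀ σ : Equiv.Perm (Fin n), permOp X σ ψ = ((Equiv.Perm.sign σ : ℤ) : ℂ) • ψ :=
  forall_congr' fun σ => antisym_iff σ ψ

noncomputable instance instCompleteSpaceAntisymm (X : Type*) [MeasureSpace X]
    [SigmaFinite (volume : Measure X)] (n : ℕ) : CompleteSpace (antisymm X n) := by
  have h : IsClosed (antisymm X n : Set (L2n X n)) := by
    have : (antisymm X n : Set (L2n X n)) = ⋂ σ : Equiv.Perm (Fin n),
        {ψ | permOp X σ ψ = ((Equiv.Perm.sign σ : ℤ) : ℂ) • ψ} := by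
      ext ψ
      simp only [SetLike.mem_coe, mem_antisymm, Set.mem_iInter, Set.mem_ofPred_eq]
    rw [this]
    exact isClosed_iInter fun σ =>
      isClosed_eq (permOp X σ).continuous (continuous_const_smul _)
  exact h.completeSpace_coe

/-- Fermionic Fock space over `L²(X)`: the Hilbert space direct sum of the spaces `L²_a(Xⁿ)`. -/
def Fock (X : Type*) [MeasureSpace X] [SigmaFinite (volume : Measure X)] : Type _ :=
  lp (fun n : ℕ => antisymm X n) 2

noncomputable instance instNormedAddCommGroupFock (X : Type*) [MeasureSpace X]
    [SigmaFinite (volume : Measure X)] : NormedAddCommGroup (Fock X) :=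
  inferInstanceAs (NormedAddCommGroup (lp (fun n : ℕ => antisymm X n) 2))

noncomputable instance instInnerProductSpaceFock (X : Type*) [MeasureSpace X]
    [SigmaFinite (volume : Measure X)] : InnerProductSpace ℂ (Fock X) :=
  inferInstanceAs (InnerProductSpace ℂ (lp (fun n : ℕ => antisymm X n) 2))

instance instCompleteSpaceFock (X : Type*) [MeasureSpace X]
    [SigmaFinite (volume : Measure X)] : CompleteSpace (Fock X) :=
  inferInstanceAs (CompleteSpace (lp (fun n : ℕ => antisymm X n) 2))

/-- The `n`-particle component `ψ⁽ⁿ⁾` of a vector of Fock space. -/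
def Fock.sector {X : Type*} [MeasureSpace X] [SigmaFinite (volume : Measure X)]
    (ψ : Fock X) (n : ℕ) : antisymm X n :=
  (show lp (fun n : ℕ => antisymm X n) 2 from ψ) n

/-- The function `x ↦ ∫ conj (f k) ψ(k, x) dk`. -/
noncomputable def annFun {X : Type*} [MeasureSpace X] {n : ℕ}
    (f : OneParticle X) (ψ : L2n X (n + 1)) (x : Fin n → X) : ℂ :=
  ∫ k : X, (starRingEnd ℂ) (f k) * ψ (Fin.cons k x)

theorem memLp_tensor {X : Type*} [MeasureSpace X] [SigmaFinite (volume : Measure X)] {n : ℕ}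
    (f : OneParticle X) (η : L2n X n) :
    MemLp (fun x : Fin (n + 1) → X => f (x 0) * η (Fin.tail x)) 2 volume := by
  have h : MemLp (fun p : X × (Fin n → X) => f p.1 * η p.2) 2
      ((volume : Measure X).prod (volume : Measure (Fin n → X))) := by
    have hf := Lp.memLp f
    have hη := Lp.memLp η
    have hm : AEStronglyMeasurable (fun p : X × (Fin n → X) => f p.1 * η p.2)
        ((volume : Measure X).prod (volume : Measure (Fin n → X))) :=
      hf.1.comp_fst.mul hη.1.comp_snd
    rw [memLp_two_iff_integrable_sq_norm hm]
    rw [memLp_two_iff_integrable_sq_norm hf.1] at hf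
    rw [memLp_two_iff_integrable_sq_norm hη.1] at hη
    have := hf.mul_prod hη
    refine this.congr (Filter.Eventually.of_forall fun p => ?_)
    simp [mul_pow]
  exact h.comp_measurePreserving (mp_uncons X n)

/-- `η ↦ f ⊗ η`. -/
noncomputable def tensor {X : Type*} [MeasureSpace X] [SigmaFinite (volume : Measure X)] {n : ℕ}
    (f : OneParticle X) (η : L2n X n) : L2n X (n + 1) :=
  (memLp_tensor f η).toLp _

theorem tensor_coe {X : Type*} [MeasureSpace X] [SigmaFinite (volume : Measure X)] {n : ℕ}
    (f : OneParticle X) (η : L2n X n) :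
    tensor f η =ᵐ[volume] fun x => f (x 0) * η (Fin.tail x) :=
  (memLp_tensor f η).coeFn_toLp

theorem ae_tail {X : Type*} [MeasureSpace X] [SigmaFinite (volume : Measure X)] {n : ℕ}
    {p : (Fin n → X) → Prop} (h : ∀ᵐ x, p x) : ∀ᵐ x : Fin (n + 1) → X, p (Fin.tail x) := by
  have h1 : ∀ᵐ q : X × (Fin n → X), p q.2 :=
    (Measure.quasiMeasurePreserving_snd (μ := (volume : Measure X))).ae h
  exact (mp_uncons X n).quasiMeasurePreserving.ae h1

theorem ae_cons {X : Type*} [MeasureSpace X] [SigmaFinite (volume : Measure X)] {n : ℕ}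
    {p : (Fin (n + 1) → X) → Prop} (h : ∀ᵐ x, p x) :
    ∀ᵐ x : Fin n → X, ∀ᵐ k : X, p (Fin.cons k x) := by
  have h1 : ∀ᵐ q : X × (Fin n → X), p (Fin.cons q.1 q.2) :=
    (mp_cons X n).quasiMeasurePreserving.ae h
  have h2 : ∀ᵐ q ∂((volume : Measure (Fin n → X)).prod (volume : Measure X)),
      p (Fin.cons q.2 q.1) :=
    (Measure.measurePreserving_swap (μ := (volume : Measure (Fin n → X)))
      (ν := (volume : Measure X))).quasiMeasurePreserving.ae h1
  exact Measure.ae_ae_of_ae_prod h2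

theorem integral_cons {X : Type*} [MeasureSpace X] [SigmaFinite (volume : Measure X)] {n : ℕ}
    (g : (Fin (n + 1) → X) → ℂ) :
    ∫ x, g x = ∫ q : X × (Fin n → X), g (Fin.cons q.1 q.2) := by
  have h := (volume_preserving_piFinSuccAbove (fun _ : Fin (n + 1) => X) 0).symm
  rw [← h.integral_comp (MeasurableEquiv.measurableEmbedding _)]
  congr 1
  funext p
  simp [MeasurableEquiv.piFinSuccAbove, Fin.insertNthEquiv]

theorem tensor_inner {X : Type*} [MeasureSpace X] [SigmaFinite (volume : Measure X)] {n : ℕ}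
    (f : OneParticle X) (η ξ : L2n X n) :
    ⟪tensor f η, tensor f ξ⟫_ℂ = ⟪f, f⟫_ℂ * ⟪η, ξ⟫_ℂ := by
  rw [L2.inner_def, L2.inner_def, L2.inner_def, ← integral_prod_mul]
  have : ∫ x, ⟪tensor f η x, tensor f ξ x⟫_ℂ =
      ∫ x : Fin (n + 1) → X, ⟪f (x 0), f (x 0)⟫_ℂ * ⟪η (Fin.tail x), ξ (Fin.tail x)⟫_ℂ := by
    apply integral_congr_ae
    filter_upwards [tensor_coe f η, tensor_coe f ξ] with x h1 h2
    rw [h1, h2]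
    simp only [RCLike.inner_apply, map_mul]
    ring
  rw [this, integral_cons]
  rfl

/-- `η ↦ f ⊗ η` as a bounded operator. -/
noncomputable def tensorL {X : Type*} [MeasureSpace X] [SigmaFinite (volume : Measure X)] {n : ℕ}
    (f : OneParticle X) : L2n X n →L[ℂ] L2n X (n + 1) :=
  LinearMap.mkContinuous
    { toFun := tensor f
      map_add' := by
        intro η ξ
        apply Lp.ext
        filter_upwards [tensor_coe f (η + ξ), tensor_coe f η, tensor_coe f ξ,
          Lp.coeFn_add (tensor f η) (tensor f ξ), ae_tail (Lp.coeFn_add η ξ)] with x a b c d e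
        rw [d, a, e, Pi.add_apply, Pi.add_apply, b, c, mul_add]
      map_smul' := by
        intro r η
        apply Lp.ext
        filter_upwards [tensor_coe f (r • η), tensor_coe f η,
          Lp.coeFn_smul r (tensor f η), ae_tail (Lp.coeFn_smul r η)] with x a b d e
        rw [RingHom.id_apply, d, a, e, Pi.smul_apply, Pi.smul_apply, b, smul_eq_mul, smul_eq_mul]
        ring }
    ‖f‖ (by
      intro η
      have h := tensor_inner f η η
      simp only [inner_self_eq_norm_sq_to_K] at h
      have h' : ‖tensor f η‖ ^ 2 = ‖f‖ ^ 2 * ‖η‖ ^ 2 := by exact_mod_cast h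
      rw [← mul_pow] at h'
      exact (pow_left_inj₀ (norm_nonneg _) (by positivity) two_ne_zero).1 h' |>.le)

theorem integrable_cons {X : Type*} [MeasureSpace X] [SigmaFinite (volume : Measure X)] {n : ℕ}
    (f : OneParticle X) (η : L2n X n) (ψ : L2n X (n + 1)) :
    Integrable (fun q : X × (Fin n → X) =>
      (starRingEnd ℂ) (η q.2) * ((starRingEnd ℂ) (f q.1) * ψ (Fin.cons q.1 q.2))) volume ∧
    ⟪tensorL f η, ψ⟫_ℂ = ∫ q : X × (Fin n → X),
      (starRingEnd ℂ) (η q.2) * ((starRingEnd ℂ) (f q.1) * ψ (Fin.cons q.1 q.2)) := by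
  have hi := L2.integrable_inner (𝕜 := ℂ) (tensor f η) ψ
  have e : (fun x => ⟪tensor f η x, ψ x⟫_ℂ) =ᵐ[volume] fun x : Fin (n + 1) → X =>
      (starRingEnd ℂ) (η (Fin.tail x)) * ((starRingEnd ℂ) (f (x 0)) * ψ x) := by
    filter_upwards [tensor_coe f η] with x a
    rw [a]
    simp only [RCLike.inner_apply, map_mul]
    ring
  have hi2 := hi.congr e
  constructor
  · have := (mp_cons X n).integrable_comp_of_integrable hi2
    simpa [Function.comp_def] using this
  · change ⟪tensor f η, ψ⟫_ℂ = _
    rw [L2.inner_def, integral_congr_ae e, integral_cons]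
    simp

theorem adjoint_tensor_coe {X : Type*} [MeasureSpace X] [SigmaFinite (volume : Measure X)] {n : ℕ}
    (f : OneParticle X) (ψ : L2n X (n + 1)) :
    ContinuousLinearMap.adjoint (tensorL f) ψ =ᵐ[volume] annFun f ψ := by
  have key : ∀ s : Set (Fin n → X), MeasurableSet s → volume s < ⊤ →
      IntegrableOn (annFun f ψ) s ∧
      ∫ x in s, ContinuousLinearMap.adjoint (tensorL f) ψ x = ∫ x in s, annFun f ψ x := by
    intro s hs hμ
    obtain ⟨h1, h2⟩ := integrable_cons f (indicatorConstLp 2 hs hμ.ne (1 : ℂ)) ψ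
    have h1' : Integrable (fun q : X × (Fin n → X) =>
      (starRingEnd ℂ) (indicatorConstLp 2 hs hμ.ne (1 : ℂ) q.2) *
        ((starRingEnd ℂ) (f q.1) * ψ (Fin.cons q.1 q.2)))
        ((volume : Measure X).prod (volume : Measure (Fin n → X))) := h1
    have e : (fun x : Fin n → X => ∫ k : X,
        (starRingEnd ℂ) (indicatorConstLp 2 hs hμ.ne (1 : ℂ) x) *
        ((starRingEnd ℂ) (f k) * ψ (Fin.cons k x))) =ᵐ[volume] s.indicator (annFun f ψ) := by
      filter_upwards [indicatorConstLp_coeFn (p := 2) (hs := hs) (hμs := hμ.ne) (c := (1 : ℂ))]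
        with x hx
      rw [hx, integral_const_mul]
      by_cases h : x ∈ s <;> simp [h, annFun]
    constructor
    · rw [← integrable_indicator_iff hs]
      exact h1'.integral_prod_right.congr e
    · rw [← L2.inner_indicatorConstLp_one (𝕜 := ℂ) hs hμ.ne,
        ContinuousLinearMap.adjoint_inner_right, h2]
      change ∫ q, _ ∂((volume : Measure X).prod (volume : Measure (Fin n → X))) = _
      rw [integral_prod_symm _ h1', integral_congr_ae e, integral_indicator hs]
  refine ae_eq_of_forall_setIntegral_eq_of_sigmaFinite ?_ (fun s hs hμ => (key s hs hμ).1)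
    (fun s hs hμ => (key s hs hμ).2)
  intro s hs hμ
  exact integrableOn_Lp_of_measure_ne_top _ (by norm_num) hμ.ne

/-- The permutation of `Fin (n + 1)` fixing `0` and acting as `e` on the other elements. -/
def liftPerm {n : ℕ} (e : Equiv.Perm (Fin n)) : Equiv.Perm (Fin (n + 1)) :=
  Equiv.Perm.decomposeFin.symm (0, e)

theorem permOp_tensor {X : Type*} [MeasureSpace X] [SigmaFinite (volume : Measure X)] {n : ℕ}
    (f : OneParticle X) (η : L2n X n) (e : Equiv.Perm (Fin n)) :
    permOp X (liftPerm e) (tensorL f η) = tensorL f (permOp X e η) := by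
  change permOp X (liftPerm e) (tensor f η) = tensor f (permOp X e η)
  apply Lp.ext
  filter_upwards [permOp_coe (liftPerm e) (tensor f η), tensor_coe f (permOp X e η),
    (mp_perm X (liftPerm e)).quasiMeasurePreserving.ae (tensor_coe f η),
    ae_tail (permOp_coe e η)] with x a b c d
  rw [a, b, c, d]
  have e0 : (x ∘ liftPerm e) 0 = x 0 := by simp [liftPerm]
  have e1 : Fin.tail (x ∘ liftPerm e) = Fin.tail x ∘ e := by
    funext i
    simp [liftPerm, Fin.tail, Equiv.Perm.decomposeFin_symm_apply_succ]
  rw [e0, e1]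

theorem sign_liftPerm {n : ℕ} (e : Equiv.Perm (Fin n)) :
    Equiv.Perm.sign (liftPerm e) = Equiv.Perm.sign e := by
  simp [liftPerm, Equiv.Perm.decomposeFin.symm_sign]

theorem exists_liftPerm {n : ℕ} (σ : Equiv.Perm (Fin (n + 1))) (h : σ 0 = 0) :
    ∃ e, σ = liftPerm e := by
  obtain ⟨⟨p, e⟩, rfl⟩ := Equiv.Perm.decomposeFin.symm.surjective σ
  refine ⟨e, ?_⟩
  rw [Equiv.Perm.decomposeFin_symm_apply_zero] at h
  rw [h, liftPerm]

theorem adjoint_mem {X : Type*} [MeasureSpace X] [SigmaFinite (volume : Measure X)] {n : ℕ}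
    (f : OneParticle X) {ψ : L2n X (n + 1)} (hψ : ψ ∈ antisymm X (n + 1)) :
    ContinuousLinearMap.adjoint (tensorL f) ψ ∈ antisymm X n := by
  rw [mem_antisymm]
  intro e
  refine ext_inner_left ℂ fun η => ?_
  have h := permOp_inner e⁻¹ η (ContinuousLinearMap.adjoint (tensorL f) ψ)
  have hi : liftPerm e⁻¹ = (liftPerm e)⁻¹ := by
    refine eq_inv_of_mul_eq_one_left (Equiv.ext fun i => ?_)
    refine Fin.cases ?_ (fun j => ?_) i
    · simp [liftPerm]
    · simp [liftPerm, Equiv.Perm.decomposeFin_symm_apply_succ]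
  rw [inv_inv] at h
  rw [← h, ContinuousLinearMap.adjoint_inner_right, ← permOp_tensor, hi, permOp_inner, inv_inv,
    (mem_antisymm.1 hψ) (liftPerm e), sign_liftPerm, inner_smul_right, inner_smul_right,
    ContinuousLinearMap.adjoint_inner_right]

theorem adjoint_swap {X : Type*} [MeasureSpace X] [SigmaFinite (volume : Measure X)] {n : ℕ}
    (f : OneParticle X) (φ : L2n X (n + 1)) :
    ContinuousLinearMap.adjoint (tensorL f) (permOp X (Equiv.swap 0 1) (tensorL f φ)) =
      tensorL f (ContinuousLinearMap.adjoint (tensorL f) φ) := by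
  change _ = tensor f _
  have h0 : ∀ᵐ z : Fin (n + 2) → X, permOp X (Equiv.swap 0 1) (tensorL f φ) z =
      f (z 1) * φ (Fin.tail (z ∘ Equiv.swap 0 1)) := by
    filter_upwards [permOp_coe (Equiv.swap 0 1) (tensorL f φ),
      (mp_perm X (Equiv.swap (0 : Fin (n + 2)) 1)).quasiMeasurePreserving.ae (tensor_coe f φ)]
      with z a b
    rw [a]
    refine b.trans ?_
    simp
  apply Lp.ext
  filter_upwards [adjoint_tensor_coe f (permOp X (Equiv.swap 0 1) (tensorL f φ)), ae_cons h0,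
    tensor_coe f (ContinuousLinearMap.adjoint (tensorL f) φ),
    ae_tail (adjoint_tensor_coe f φ)] with y a b c d
  rw [a, c, d, annFun, annFun, ← integral_const_mul]
  apply integral_congr_ae
  filter_upwards [b] with k hk
  rw [hk]
  have e : Fin.tail ((Fin.cons k y : Fin (n + 2) → X) ∘ Equiv.swap 0 1) =
      Fin.cons k (Fin.tail y) := by
    funext i
    refine Fin.cases ?_ (fun j => ?_) i
    · simp [Fin.tail]
    · have : Equiv.swap (0 : Fin (n + 2)) 1 j.succ.succ = j.succ.succ := by
        apply Equiv.swap_apply_of_ne_of_ne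
        · exact Fin.succ_ne_zero _
        · intro h
          have := Fin.succ_injective _ (h.trans Fin.succ_zero_eq_one.symm)
          exact Fin.succ_ne_zero _ this
      simp [Fin.tail, this]
  rw [e]
  simp only [← Fin.succ_zero_eq_one, Fin.cons_succ]
  ring

/-- For antisymmetric `φ` and a permutation moving `0`, the cross terms are nonpositive. -/
theorem cross_term {X : Type*} [MeasureSpace X] [SigmaFinite (volume : Measure X)] {n : ℕ}
    (f : OneParticle X) {φ : L2n X n} (hφ : φ ∈ antisymm X n)
    (τ : Equiv.Perm (Fin (n + 1))) (hτ : τ 0 ≠ 0) :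
    (((Equiv.Perm.sign τ : ℤ) : ℂ) * ⟪tensorL f φ, permOp X τ (tensorL f φ)⟫_ℂ).re ≤ 0 := by
  have hfix : ∀ σ : Equiv.Perm (Fin (n + 1)), σ 0 = 0 →
      permOp X σ (tensorL f φ) = ((Equiv.Perm.sign σ : ℤ) : ℂ) • tensorL f φ := by
    intro σ hσ
    obtain ⟨e, rfl⟩ := exists_liftPerm σ hσ
    rw [permOp_tensor, (mem_antisymm.1 hφ) e, map_smul, sign_liftPerm]
  obtain _ | m := n
  · exact absurd (Subsingleton.elim (α := Fin 1) _ _) hτ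
  set ρ : Equiv.Perm (Fin (m + 2)) := Equiv.swap 1 (τ 0) with hρ
  set s : Equiv.Perm (Fin (m + 2)) := Equiv.swap 0 1 with hs
  have hρ0 : ρ 0 = 0 := Equiv.swap_apply_of_ne_of_ne (by simp) hτ.symm
  have h0 : (s * ρ * τ) 0 = 0 := by simp [hρ, hs]
  have hdec : τ = ρ * (s * (s * ρ * τ)) := by
    have h1 : ρ * ρ = 1 := Equiv.swap_mul_self _ _
    have h2 : s * s = 1 := Equiv.swap_mul_self _ _
    calc τ = ρ * ρ * τ := by rw [h1, one_mul]
      _ = ρ * (s * s) * ρ * τ := by rw [h2, mul_one]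
      _ = _ := by simp only [mul_assoc]
  have hsgn : ∀ σ : Equiv.Perm (Fin (m + 2)),
      ((Equiv.Perm.sign σ : ℤ) : ℂ) * ((Equiv.Perm.sign σ : ℤ) : ℂ) = 1 := by
    intro σ
    rcases Int.units_eq_one_or (Equiv.Perm.sign σ) with h | h <;> simp [h]
  have hU : permOp X τ (tensorL f φ) = ((Equiv.Perm.sign (s * ρ * τ) : ℤ) : ℂ) •
      permOp X ρ (permOp X s (tensorL f φ)) := by
    conv_lhs => rw [hdec]
    rw [← permOp_mul, ← permOp_mul, hfix _ h0, map_smul, map_smul]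
  have hinv : ρ⁻¹ = ρ := Equiv.swap_inv _ _
  have h1 : ⟪tensorL f φ, permOp X ρ (permOp X s (tensorL f φ))⟫_ℂ =
      ((Equiv.Perm.sign ρ : ℤ) : ℂ) * ⟪tensorL f φ, permOp X s (tensorL f φ)⟫_ℂ := by
    rw [← hinv, ← permOp_inner, hfix ρ hρ0, inner_smul_left, hinv]
    simp
  have h2 : ⟪tensorL f φ, permOp X s (tensorL f φ)⟫_ℂ =
      (‖ContinuousLinearMap.adjoint (tensorL f) φ‖ : ℂ) ^ 2 := by
    rw [← ContinuousLinearMap.adjoint_inner_right, adjoint_swap,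
      ← ContinuousLinearMap.adjoint_inner_left, inner_self_eq_norm_sq_to_K]
    rfl
  have hs1 : Equiv.Perm.sign s = -1 := Equiv.Perm.sign_swap (by simp)
  have hss : ((Equiv.Perm.sign (s * ρ * τ) : ℤ) : ℂ) =
      - (((Equiv.Perm.sign ρ : ℤ) : ℂ) * ((Equiv.Perm.sign τ : ℤ) : ℂ)) := by
    rw [map_mul, map_mul, hs1]; push_cast; ring
  rw [hU, inner_smul_right, h1, h2, hss]
  have : ((Equiv.Perm.sign τ : ℤ) : ℂ) * (-(((Equiv.Perm.sign ρ : ℤ) : ℂ) *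
      ((Equiv.Perm.sign τ : ℤ) : ℂ)) * (((Equiv.Perm.sign ρ : ℤ) : ℂ) *
      (‖ContinuousLinearMap.adjoint (tensorL f) φ‖ : ℂ) ^ 2)) =
      ((-‖ContinuousLinearMap.adjoint (tensorL f) φ‖ ^ 2 : ℝ) : ℂ) := by
    push_cast
    linear_combination (-(‖ContinuousLinearMap.adjoint (tensorL f) φ‖ : ℂ) ^ 2) *
      (((Equiv.Perm.sign τ : ℤ) : ℂ) * ((Equiv.Perm.sign τ : ℤ) : ℂ) * hsgn ρ + hsgn τ)
  rw [this, Complex.ofReal_re]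
  nlinarith [sq_nonneg ‖ContinuousLinearMap.adjoint (tensorL f) φ‖]

theorem sqrt_bound {X : Type*} [MeasureSpace X] [SigmaFinite (volume : Measure X)] {n : ℕ}
    (f : OneParticle X) {ψ : L2n X (n + 1)} (hψ : ψ ∈ antisymm X (n + 1)) :
    √(n + 1) * ‖ContinuousLinearMap.adjoint (tensorL f) ψ‖ ≤ ‖f‖ * ‖ψ‖ := by
  set φ := ContinuousLinearMap.adjoint (tensorL f) ψ with hφd
  have hφ : φ ∈ antisymm X n := adjoint_mem f hψ
  let w : Fin (n + 1) → Equiv.Perm (Fin (n + 1)) := fun j => Equiv.swap 0 j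
  let e : Fin (n + 1) → L2n X (n + 1) := fun j =>
    ((Equiv.Perm.sign (w j) : ℤ) : ℂ) • permOp X (w j) (tensorL f φ)
  have hT : ‖tensorL f φ‖ ^ 2 = ‖f‖ ^ 2 * ‖φ‖ ^ 2 := by
    have h : ⟪tensorL f φ, tensorL f φ⟫_ℂ = _ := tensor_inner f φ φ
    simp only [inner_self_eq_norm_sq_to_K] at h
    exact_mod_cast h
  have hinv : ∀ j, (w j)⁻¹ = w j := fun j => Equiv.swap_inv _ _
  have hsgn : ∀ σ : Equiv.Perm (Fin (n + 1)),
      ((Equiv.Perm.sign σ : ℤ) : ℂ) * ((Equiv.Perm.sign σ : ℤ) : ℂ) = 1 := by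
    intro σ
    rcases Int.units_eq_one_or (Equiv.Perm.sign σ) with h | h <;> simp [h]
  have h1 : ∀ j, ⟪e j, ψ⟫_ℂ = ((‖φ‖ ^ 2 : ℝ) : ℂ) := by
    intro j
    have : ⟪tensorL f φ, ψ⟫_ℂ = ((‖φ‖ ^ 2 : ℝ) : ℂ) := by
      rw [← ContinuousLinearMap.adjoint_inner_right, ← hφd, inner_self_eq_norm_sq_to_K]
      norm_cast
    simp only [e]
    rw [inner_smul_left, permOp_inner, hinv, mem_antisymm.1 hψ, inner_smul_right, this, ← mul_assoc]
    simp only [map_intCast]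
    rw [hsgn, one_mul]
  have h2 : ⟪∑ j, e j, ψ⟫_ℂ = (((n + 1) * ‖φ‖ ^ 2 : ℝ) : ℂ) := by
    rw [sum_inner, Finset.sum_congr rfl fun j _ => h1 j]
    simp
  have h3 : ∀ i j, i ≠ j → (⟪e i, e j⟫_ℂ).re ≤ 0 := by
    intro i j hij
    have hne : (w i * w j) 0 ≠ 0 := by
      intro h
      have h' : w i j = 0 := by simpa [w] using h
      have : w i (w i j) = w i 0 := by rw [h']
      simp [w] at this
      exact hij this.symm
    have := cross_term f hφ (w i * w j) hne
    refine le_trans (le_of_eq ?_) this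
    simp only [e]
    rw [inner_smul_left, inner_smul_right, permOp_inner, hinv, permOp_mul, map_mul]
    simp only [map_intCast]
    push_cast
    rw [mul_assoc]
  have h4 : ∀ i, (⟪e i, e i⟫_ℂ).re = ‖f‖ ^ 2 * ‖φ‖ ^ 2 := by
    intro i
    simp only [e]
    rw [inner_smul_left, inner_smul_right, (permOp X (w i)).inner_map_map, ← mul_assoc]
    simp only [map_intCast]
    rw [hsgn, one_mul, inner_self_eq_norm_sq_to_K, ← hT]
    norm_cast
  have h5 : ‖∑ j, e j‖ ^ 2 ≤ (n + 1) * (‖f‖ ^ 2 * ‖φ‖ ^ 2) := by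
    have : ‖∑ j, e j‖ ^ 2 = ∑ i, ∑ j, (⟪e i, e j⟫_ℂ).re := by
      have h : ((‖∑ j, e j‖ ^ 2 : ℝ) : ℂ) = ⟪∑ j, e j, ∑ j, e j⟫_ℂ := by
        rw [inner_self_eq_norm_sq_to_K]; norm_cast
      have h' := congrArg Complex.re h
      rw [Complex.ofReal_re] at h'
      rw [h', sum_inner, Complex.re_sum]
      refine Finset.sum_congr rfl fun i _ => ?_
      rw [inner_sum, Complex.re_sum]
    rw [this]
    calc ∑ i, ∑ j, (⟪e i, e j⟫_ℂ).re
        ≤ ∑ i : Fin (n + 1), ∑ j, if i = j then ‖f‖ ^ 2 * ‖φ‖ ^ 2 else 0 := by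
          refine Finset.sum_le_sum fun i _ => Finset.sum_le_sum fun j _ => ?_
          split_ifs with h
          · rw [← h, h4]
          · exact h3 i j h
      _ = _ := by simp
  have h6 : (n + 1) * ‖φ‖ ^ 2 ≤ ‖∑ j, e j‖ * ‖ψ‖ := by
    have := norm_inner_le_norm (𝕜 := ℂ) (∑ j, e j) ψ
    rw [h2, Complex.norm_real, Real.norm_of_nonneg (by positivity)] at this
    exact this
  have h7 : ‖∑ j, e j‖ ≤ √(n + 1) * (‖f‖ * ‖φ‖) := by
    apply le_of_sq_le_sq _ (by positivity)
    rw [mul_pow, Real.sq_sqrt (by positivity), mul_pow]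
    exact h5
  rcases (norm_nonneg φ).eq_or_lt with h | h
  · rw [← h, mul_zero]; positivity
  · have hs : √((n : ℝ) + 1) * √((n : ℝ) + 1) = n + 1 := Real.mul_self_sqrt (by positivity)
    have hs0 : 0 < √((n : ℝ) + 1) := Real.sqrt_pos.2 (by positivity)
    have h8 : (√((n : ℝ) + 1) * ‖φ‖) * (√((n : ℝ) + 1) * ‖φ‖) ≤
        (√((n : ℝ) + 1) * ‖φ‖) * (‖f‖ * ‖ψ‖) := by
      calc _ = (√((n : ℝ) + 1) * √((n : ℝ) + 1)) * ‖φ‖ ^ 2 := by ring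
        _ ≤ ‖∑ j, e j‖ * ‖ψ‖ := by rw [hs]; exact h6
        _ ≤ √(n + 1) * (‖f‖ * ‖φ‖) * ‖ψ‖ := by gcongr
        _ = _ := by ring
    exact le_of_mul_le_mul_left h8 (by positivity)

/-- `T` is the annihilation operator of `f`:
`(T ψ)⁽ⁿ⁾(x) = √(n + 1) ∫ conj (f k) ψ⁽ⁿ⁺¹⁾(k, x) dk` for every `n` and almost every `x`. -/
def IsAnnihilation {X : Type*} [MeasureSpace X] [SigmaFinite (volume : Measure X)]
    (f : OneParticle X) (T : Fock X →L[ℂ] Fock X) : Prop :=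
  ∀ (ψ : Fock X) (n : ℕ), ∀ᵐ x : Fin n → X,
    ((T ψ).sector n : L2n X n) x =
      √((n : ℝ) + 1) * ∫ k : X, (starRingEnd ℂ) (f k) * (ψ.sector (n + 1) : L2n X (n + 1)) (Fin.cons k x)

theorem isAnnihilation_unique {X : Type*} [MeasureSpace X] [SigmaFinite (volume : Measure X)]
    {f : OneParticle X} {S T : Fock X →L[ℂ] Fock X}
    (hS : IsAnnihilation f S) (hT : IsAnnihilation f T) : S = T := by
  ext ψ : 1
  apply lp.ext
  funext n
  apply Subtype.ext
  apply Lp.ext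
  filter_upwards [hS ψ n, hT ψ n] with x a b
  exact a.trans b.symm

/-- There is a bounded operator given by the above formula (and it has norm at most `‖f‖`). -/
theorem exists_annihilation {X : Type*} [MeasureSpace X] [SigmaFinite (volume : Measure X)]
    (f : OneParticle X) :
    ∃ T : Fock X →L[ℂ] Fock X, IsAnnihilation f T ∧ ‖T‖ ≤ ‖f‖ := by
  let S : ∀ n, antisymm X (n + 1) →ₗ[ℂ] antisymm X n := fun n =>
    { toFun := fun ψ => ⟨((√((n : ℝ) + 1) : ℝ) : ℂ) •
        ContinuousLinearMap.adjoint (tensorL f) (ψ : L2n X (n + 1)),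
        (antisymm X n).smul_mem _ (adjoint_mem f ψ.2)⟩
      map_add' := fun a b => by ext1; simp
      map_smul' := fun c a => by
        ext1
        simp only [SetLike.val_smul, map_smul, RingHom.id_apply]
        rw [smul_comm] }
  have hS : ∀ n ψ, ‖S n ψ‖ ≤ ‖f‖ * ‖ψ‖ := by
    intro n ψ
    have := sqrt_bound f ψ.2
    change ‖((√((n : ℝ) + 1) : ℝ) : ℂ) • ContinuousLinearMap.adjoint (tensorL f) (ψ : L2n X (n + 1))‖
      ≤ _
    rw [norm_smul, Complex.norm_real, Real.norm_of_nonneg (Real.sqrt_nonneg _)]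
    exact this
  have htwo : 0 < (2 : ENNReal).toReal := by norm_num
  have hsum : ∀ ψ : Fock X, Summable fun n => ‖ψ.sector n‖ ^ 2 := by
    intro ψ
    have := (lp.memℓp ψ).summable htwo
    refine this.congr fun n => ?_
    simp only [ENNReal.toReal_ofNat, Real.rpow_ofNat]
    rfl
  have hnorm : ∀ ψ : Fock X, ‖ψ‖ ^ 2 = ∑' n, ‖ψ.sector n‖ ^ 2 := by
    intro ψ
    have := lp.norm_rpow_eq_tsum htwo ψ
    simp only [ENNReal.toReal_ofNat, Real.rpow_ofNat] at this
    exact this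
  have hle : ∀ (ψ : Fock X) n, ‖S n (ψ.sector (n + 1))‖ ^ 2 ≤ ‖f‖ ^ 2 * ‖ψ.sector (n + 1)‖ ^ 2 := by
    intro ψ n
    rw [← mul_pow]
    exact pow_le_pow_left₀ (norm_nonneg _) (hS n _) 2
  have hsum1 : ∀ ψ : Fock X, Summable fun n => ‖f‖ ^ 2 * ‖ψ.sector (n + 1)‖ ^ 2 := fun ψ =>
    ((summable_nat_add_iff 1).2 (hsum ψ)).mul_left _
  have hsum2 : ∀ ψ : Fock X, Summable fun n => ‖S n (ψ.sector (n + 1))‖ ^ 2 := fun ψ =>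
    Summable.of_nonneg_of_le (fun _ => by positivity) (hle ψ) (hsum1 ψ)
  have hmem : ∀ ψ : Fock X, Memℓp (fun n => S n (ψ.sector (n + 1))) 2 := by
    intro ψ
    apply memℓp_gen
    simpa using hsum2 ψ
  let T0 : Fock X →ₗ[ℂ] Fock X :=
    { toFun := fun ψ => ⟨fun n => S n (ψ.sector (n + 1)), hmem ψ⟩
      map_add' := fun a b => by
        apply lp.ext; funext n
        exact map_add (S n) _ _
      map_smul' := fun c a => by
        apply lp.ext; funext n
        exact map_smul (S n) _ _ }
  have hT0 : ∀ ψ, ‖T0 ψ‖ ≤ ‖f‖ * ‖ψ‖ := by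
    intro ψ
    apply le_of_sq_le_sq _ (by positivity)
    rw [mul_pow, hnorm (T0 ψ), hnorm ψ]
    calc ∑' n, ‖S n (ψ.sector (n + 1))‖ ^ 2 ≤ ∑' n, ‖f‖ ^ 2 * ‖ψ.sector (n + 1)‖ ^ 2 :=
          (hsum2 ψ).tsum_le_tsum (hle ψ) (hsum1 ψ)
      _ = ‖f‖ ^ 2 * ∑' n, ‖ψ.sector (n + 1)‖ ^ 2 := tsum_mul_left
      _ ≤ _ := by
        refine mul_le_mul_of_nonneg_left ?_ (sq_nonneg _)
        exact le_trans (le_add_of_nonneg_left (sq_nonneg _)) (hsum ψ).tsum_eq_zero_add.ge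
  refine ⟨T0.mkContinuous ‖f‖ hT0, ?_, LinearMap.mkContinuous_norm_le _ (norm_nonneg _) _⟩
  intro ψ n
  have h : ((T0.mkContinuous ‖f‖ hT0 ψ).sector n : L2n X n) = ((√((n : ℝ) + 1) : ℝ) : ℂ) •
      ContinuousLinearMap.adjoint (tensorL f) (ψ.sector (n + 1) : L2n X (n + 1)) := rfl
  rw [h]
  filter_upwards [Lp.coeFn_smul ((√((n : ℝ) + 1) : ℝ) : ℂ)
    (ContinuousLinearMap.adjoint (tensorL f) (ψ.sector (n + 1) : L2n X (n + 1))),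
    adjoint_tensor_coe f (ψ.sector (n + 1) : L2n X (n + 1))] with x a b
  rw [a, Pi.smul_apply, b, smul_eq_mul]
  rfl

/-- The annihilation operator `a(f)` on Fock space: the unique bounded operator with
`(a(f) ψ)⁽ⁿ⁾(x) = √(n + 1) ∫ conj (f k) ψ⁽ⁿ⁺¹⁾(k, x) dk`. -/
noncomputable def annihilation {X : Type*} [MeasureSpace X] [SigmaFinite (volume : Measure X)]
    (f : OneParticle X) : Fock X →L[ℂ] Fock X :=
  Classical.choose (exists_annihilation f)

theorem isAnnihilation_annihilation {X : Type*} [MeasureSpace X]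
    [SigmaFinite (volume : Measure X)] (f : OneParticle X) :
    IsAnnihilation f (annihilation f) :=
  (Classical.choose_spec (exists_annihilation f)).1

/-- The CAR algebra over `L²(X)`: the (unital) C*-algebra of operators on Fock space generated by
all annihilation operators. The star of an operator is its Hilbert space adjoint. -/
noncomputable def carAlgebra (X : Type*) [MeasureSpace X] [SigmaFinite (volume : Measure X)] :
    StarSubalgebra ℂ (Fock X →L[ℂ] Fock X) :=
  (StarAlgebra.adjoin ℂ (Set.range (annihilation (X := X)))).topologicalClosure

/-- The CAR algebra as a type. -/
def CAR (X : Type*) [MeasureSpace X] [SigmaFinite (volume : Measure X)] : Type _ :=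
  carAlgebra X

/-- The CAR algebra carries the operations and the norm of the operators on Fock space. -/
noncomputable instance instCStarAlgebraCAR (X : Type*) [MeasureSpace X]
    [SigmaFinite (volume : Measure X)] : CStarAlgebra (CAR X) :=
  haveI : IsClosed (carAlgebra X : Set (Fock X →L[ℂ] Fock X)) :=
    StarSubalgebra.isClosed_topologicalClosure _
  inferInstanceAs (CStarAlgebra (carAlgebra X))

/-- `a(f)` as an element of the CAR algebra. -/
noncomputable def ann {X : Type*} [MeasureSpace X] [SigmaFinite (volume : Measure X)]
    (f : OneParticle X) : CAR X :=
  ⟨annihilation f, StarSubalgebra.le_topologicalClosure _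
    (StarAlgebra.subset_adjoin ℂ _ (Set.mem_range_self f))⟩

/-- `a†(f)`, the adjoint of `a(f)`. -/
noncomputable def cre {X : Type*} [MeasureSpace X] [SigmaFinite (volume : Measure X)]
    (f : OneParticle X) : CAR X :=
  star (ann f)

/-- The unital C*-subalgebra of the CAR algebra generated by `a(f)`, `f ∈ S`. -/
noncomputable def subCAR {X : Type*} [MeasureSpace X] [SigmaFinite (volume : Measure X)]
    (S : Set (OneParticle X)) : StarSubalgebra ℂ (CAR X) :=
  (StarAlgebra.adjoin ℂ (ann '' S)).topologicalClosure

/-- Products of an even number of factors, each of them `a(f)` or `a†(f)` with `f ∈ S`. -/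
def evenMonomials {X : Type*} [MeasureSpace X] [SigmaFinite (volume : Measure X)]
    (S : Set (OneParticle X)) : Set (CAR X) :=
  {A | ∃ l : List (CAR X), Even l.length ∧ (∀ B ∈ l, B ∈ ann '' S ∪ cre '' S) ∧ A = l.prod}

/-- The C*-subalgebra generated by the even monomials over `S`. -/
noncomputable def evenCAR {X : Type*} [MeasureSpace X] [SigmaFinite (volume : Measure X)]
    (S : Set (OneParticle X)) : StarSubalgebra ℂ (CAR X) :=
  (StarAlgebra.adjoin ℂ (evenMonomials S)).topologicalClosure

/-- The four unitaries `1`, `a†(f) + a(f)`, `a†(f) - a(f)`, `1 - 2 a†(f) a(f)` of a mode `f`. -/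
noncomputable def kraus {X : Type*} [MeasureSpace X] [SigmaFinite (volume : Measure X)]
    (f : OneParticle X) : Fin 4 → CAR X :=
  ![1, cre f + ann f, cre f - ann f, 1 - 2 * (cre f * ann f)]

/-- The unitaries of the `n`-th mode of a finite (`M < ⊤`) or infinite (`M = ⊤`) sequence of `M`
modes; for `n ≥ M` there is no mode and they are all `1`. -/
noncomputable def modeKraus {X : Type*} [MeasureSpace X] [SigmaFinite (volume : Measure X)]
    {M : ℕ∞} (f : {n : ℕ // (n : ℕ∞) < M} → OneParticle X) (n : ℕ) (α : Fin 4) :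
    CAR X :=
  open Classical in if h : (n : ℕ∞) < M then kraus (f ⟨n, h⟩) α else 1

/-- The ordered product `u(α) = u₁^(α₁) ⋯ u_N^(α_N)`. -/
noncomputable def krausProd {X : Type*} [MeasureSpace X] [SigmaFinite (volume : Measure X)]
    {M : ℕ∞} (f : {n : ℕ // (n : ℕ∞) < M} → OneParticle X) {N : ℕ}
    (α : Fin N → Fin 4) : CAR X :=
  (List.ofFn fun n : Fin N => modeKraus f n (α n)).prod

/-- `E^N(A) = 4^{-N} ∑_α u(α)* A u(α)`. If there are only `M < ⊤` modes, then `E^N = E^M` for all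
`N ≥ M`. -/
noncomputable def condExpN {X : Type*} [MeasureSpace X] [SigmaFinite (volume : Measure X)]
    {M : ℕ∞} (f : {n : ℕ // (n : ℕ∞) < M} → OneParticle X) (N : ℕ) (A : CAR X) :
    CAR X :=
  ((4 : ℂ) ^ N)⁻¹ • ∑ α : Fin N → Fin 4, star (krausProd f α) * A * krausProd f α

/-- The monomial `a†(g_{i_m}) ⋯ a†(g_{i_1}) a(g_{j_1}) ⋯ a(g_{j_n})`. -/
noncomputable def normalMonomial {X : Type*} [MeasureSpace X] [SigmaFinite (volume : Measure X)]
    {ι : Type*} (g : ι → OneParticle X) (i j : List ι) : CAR X :=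
  (i.reverse.map fun k => cre (g k)).prod * (j.map fun k => ann (g k)).prod

/-- `ω` is the quasi-free tracial state, written in terms of an orthonormal basis `g`. -/
structure IsTracialState {X : Type*} [MeasureSpace X] [SigmaFinite (volume : Measure X)]
    {ι : Type*} (g : ι → OneParticle X) (ω : CAR X →L[ℂ] ℂ) : Prop where
  map_one : ω 1 = 1
  nonneg : ∀ A : CAR X, 0 ≤ (ω (star A * A)).re ∧ (ω (star A * A)).im = 0
  tracial : ∀ A B : CAR X, ω (A * B) = ω (B * A)
  diagonal : ∀ i : List ι, i.Nodup → ω (normalMonomial g i i) = 1 / 2 ^ i.length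
  offDiagonal : ∀ i j : List ι, {k | k ∈ i} ≠ {k | k ∈ j} → ω (normalMonomial g i j) = 0

end FermiFock

/-!
The unitaries `u_n^{(α)}` of the modes `f_n` commute or anticommute with all letters of the other
modes and with each other, so `E^N` is the product of commuting one-mode averages
`Φ_n(A) = ¼ ∑_α u_n^{(α)*} A u_n^{(α)}`. By the canonical anticommutation relations
(`ann_mul_ann`, `ann_mul_cre`), which are obtained from an explicit formula for the adjoint of `a(f)`
on each particle sector, `Φ_n` is the norm-one projection onto the commutant of `a(f_n)` and
`a†(f_n)`, and it satisfies `Φ_n(xA) = Φ_n(Ax)` for `x` one of these two operators.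

A word in creation and annihilation operators of `𝔎` and of finitely many modes is fixed by `Φ_n` for
large `n` if its length is even, and killed if its length is odd, so `E^N` is eventually constant on
words, and as `‖E^N‖ ≤ 1` and words are total, the limit `E` exists (`exists_condExp`). It inherits
`E ∘ Φ_n = Φ_n ∘ E = E`, hence its values commute with all modes, it fixes everything that does, and
`E(xA) = E(Ax)` for letters `x` of the modes.

This trace property computes `E` on words, as in the Wick theorem (`condExp_even_word`): in a word
`p x q` of even length with `x` a letter of a mode, moving `x` to the left end and to the right end
produces opposite signs, so that `2 E(p x q)` is `E` of a combination of words shorter by two letters.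
Thus `E` maps even words to combinations of even words over `𝔎`, and in particular to scalars if
all letters belong to modes. An odd word in letters of modes anticommutes with an invertible element
of the algebra of the modes, the product of finitely many `1 - 2 a†a`, and so is mapped to zero by
the trace property. This determines `E` on the algebra of the modes; a normalized trace is
invariant under the averages, so there `E` is given by any such trace.

The tracial state itself is obtained by taking all elements of the Hilbert basis `g`, enumerated by
natural numbers, as modes: then `E` is scalar valued on the whole CAR algebra, its composition with
a vector state is the tracial state, and uniqueness is the last remark of the previous paragraph.
-/

namespace FermiFock

/-! ### Tensoring with a one-particle vector -/

theorem tail_cons_comp_swap {Y : Type*} {n : ℕ} (k : Y) (y : Fin (n + 1) → Y) :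
    Fin.tail ((Fin.cons k y : Fin (n + 2) → Y) ∘ Equiv.swap 0 1) = Fin.cons k (Fin.tail y) := by
  funext i
  refine Fin.cases ?_ (fun j => ?_) i
  · simp [Fin.tail]
  · have : Equiv.swap (0 : Fin (n + 2)) 1 j.succ.succ = j.succ.succ := by
      apply Equiv.swap_apply_of_ne_of_ne
      · exact Fin.succ_ne_zero _
      · intro h
        have := Fin.succ_injective _ (h.trans Fin.succ_zero_eq_one.symm)
        exact Fin.succ_ne_zero _ this
    simp [Fin.tail, this]

section FockSpace

variable {X : Type*} [MeasureSpace X] [SigmaFinite (volume : Measure X)]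

theorem ae_head {n : ℕ} {p : X → Prop} (h : ∀ᵐ x, p x) :
    ∀ᵐ x : Fin (n + 1) → X, p (x 0) := by
  have h1 : ∀ᵐ q : X × (Fin n → X), p q.1 :=
    (Measure.quasiMeasurePreserving_fst (ν := (volume : Measure (Fin n → X)))).ae h
  exact (mp_uncons X n).quasiMeasurePreserving.ae h1

theorem tensorL_coe {n : ℕ} (f : OneParticle X) (η : L2n X n) :
    tensorL f η =ᵐ[volume] fun x => f (x 0) * η (Fin.tail x) :=
  tensor_coe f η

theorem tensorL_add {n : ℕ} (f g : OneParticle X) :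
    (tensorL (f + g) : L2n X n →L[ℂ] L2n X (n + 1)) = tensorL f + tensorL g := by
  ext1 η
  rw [add_apply]
  apply Lp.ext
  filter_upwards [tensorL_coe (f + g) η, tensorL_coe f η, tensorL_coe g η,
    Lp.coeFn_add (tensorL f η) (tensorL g η), ae_head (Lp.coeFn_add f g)] with x a b c d e
  rw [d, a, e, Pi.add_apply, Pi.add_apply, b, c, add_mul]

theorem tensorL_smul {n : ℕ} (r : ℂ) (f : OneParticle X) :
    (tensorL (r • f) : L2n X n →L[ℂ] L2n X (n + 1)) = r • tensorL f := by
  ext1 η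
  rw [smul_apply]
  apply Lp.ext
  filter_upwards [tensorL_coe (r • f) η, tensorL_coe f η,
    Lp.coeFn_smul r (tensorL f η), ae_head (Lp.coeFn_smul r f)] with x a b d e
  rw [d, a, e, Pi.smul_apply, Pi.smul_apply, b, smul_eq_mul, smul_eq_mul, mul_assoc]

theorem inner_tensorL_tensorL {n : ℕ} (f g : OneParticle X) (η ξ : L2n X n) :
    ⟪tensorL f η, tensorL g ξ⟫_ℂ = ⟪f, g⟫_ℂ * ⟪η, ξ⟫_ℂ := by
  rw [L2.inner_def, L2.inner_def, L2.inner_def, ← integral_prod_mul]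
  have : ∫ x, ⟪tensorL f η x, tensorL g ξ x⟫_ℂ =
      ∫ x : Fin (n + 1) → X, ⟪f (x 0), g (x 0)⟫_ℂ * ⟪η (Fin.tail x), ξ (Fin.tail x)⟫_ℂ := by
    apply integral_congr_ae
    filter_upwards [tensorL_coe f η, tensorL_coe g ξ] with x h1 h2
    rw [h1, h2]
    simp only [RCLike.inner_apply, map_mul]
    ring
  rw [this, integral_cons]
  rfl

theorem adjoint_tensorL_tensorL {n : ℕ} (f g : OneParticle X) (η : L2n X n) :
    ContinuousLinearMap.adjoint (tensorL g) (tensorL f η) = ⟪g, f⟫_ℂ • η := by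
  refine ext_inner_left ℂ fun ξ => ?_
  rw [ContinuousLinearMap.adjoint_inner_right, inner_tensorL_tensorL, inner_smul_right]

theorem adjoint_permOp_swap_tensorL {n : ℕ} (f g : OneParticle X) (φ : L2n X (n + 1)) :
    ContinuousLinearMap.adjoint (tensorL g) (permOp X (Equiv.swap 0 1) (tensorL f φ)) =
      tensorL f (ContinuousLinearMap.adjoint (tensorL g) φ) := by
  have h0 : ∀ᵐ z : Fin (n + 2) → X, permOp X (Equiv.swap 0 1) (tensorL f φ) z =
      f (z 1) * φ (Fin.tail (z ∘ Equiv.swap 0 1)) := by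
    filter_upwards [permOp_coe (Equiv.swap 0 1) (tensorL f φ),
      (mp_perm X (Equiv.swap (0 : Fin (n + 2)) 1)).quasiMeasurePreserving.ae (tensorL_coe f φ)]
      with z a b
    rw [a]
    refine b.trans ?_
    simp
  apply Lp.ext
  filter_upwards [adjoint_tensor_coe g (permOp X (Equiv.swap 0 1) (tensorL f φ)), ae_cons h0,
    tensorL_coe f (ContinuousLinearMap.adjoint (tensorL g) φ),
    ae_tail (adjoint_tensor_coe g φ)] with y a b c d
  rw [a, c, d, annFun, annFun, ← integral_const_mul]
  apply integral_congr_ae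
  filter_upwards [b] with k hk
  rw [hk, tail_cons_comp_swap]
  simp only [← Fin.succ_zero_eq_one, Fin.cons_succ]
  ring

/-- Exchanging the first two variables exchanges the factors of `f ⊗ g ⊗ η`. -/
theorem permOp_swap_tensorL_tensorL {n : ℕ} (f g : OneParticle X) (η : L2n X n) :
    permOp X (Equiv.swap 0 1) (tensorL f (tensorL g η)) = tensorL g (tensorL f η) := by
  apply Lp.ext
  filter_upwards [permOp_coe (Equiv.swap 0 1) (tensorL f (tensorL g η)),
    (mp_perm X (Equiv.swap (0 : Fin (n + 2)) 1)).quasiMeasurePreserving.ae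
      (tensorL_coe f (tensorL g η)),
    (mp_perm X (Equiv.swap (0 : Fin (n + 2)) 1)).quasiMeasurePreserving.ae
      (ae_tail (tensorL_coe g η)),
    tensorL_coe g (tensorL f η), ae_tail (tensorL_coe f η)] with x a b c d e
  rw [a, d, e]
  refine b.trans ?_
  rw [c]
  have h : Fin.tail (Fin.tail (x ∘ Equiv.swap 0 1)) = Fin.tail (Fin.tail x) := by
    conv_lhs => rw [← Fin.cons_self_tail x]
    rw [tail_cons_comp_swap, Fin.tail_cons]
  rw [h]
  simp [Fin.tail]
  ring

/-- The sum of `f ⊗ φ` with the variables `0` and `j` exchanged, over all `j`, with the sign of this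
permutation. For antisymmetric `φ` of `n` variables this is `n + 1` times the antisymmetrization
of `f ⊗ φ`. -/
noncomputable def wedge {n : ℕ} (f : OneParticle X) : L2n X n →L[ℂ] L2n X (n + 1) :=
  ∑ j : Fin (n + 1), ((Equiv.Perm.sign (Equiv.swap 0 j) : ℤ) : ℂ) •
    (permOp X (Equiv.swap 0 j)).toContinuousLinearMap ∘L tensorL f

theorem wedge_apply {n : ℕ} (f : OneParticle X) (φ : L2n X n) :
    wedge f φ = ∑ j : Fin (n + 1), ((Equiv.Perm.sign (Equiv.swap 0 j) : ℤ) : ℂ) •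
      permOp X (Equiv.swap 0 j) (tensorL f φ) := by
  simp [wedge]

theorem sign_mul_self {n : ℕ} (σ : Equiv.Perm (Fin n)) :
    ((Equiv.Perm.sign σ : ℤ) : ℂ) * ((Equiv.Perm.sign σ : ℤ) : ℂ) = 1 := by
  rcases Int.units_eq_one_or (Equiv.Perm.sign σ) with h | h <;> simp [h]

theorem permOp_tensorL_of_apply_zero {n : ℕ} (f : OneParticle X) {φ : L2n X n}
    (hφ : φ ∈ antisymm X n) {σ : Equiv.Perm (Fin (n + 1))} (hσ : σ 0 = 0) :
    permOp X σ (tensorL f φ) = ((Equiv.Perm.sign σ : ℤ) : ℂ) • tensorL f φ := by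
  obtain ⟨e, rfl⟩ := exists_liftPerm σ hσ
  rw [permOp_tensor, (mem_antisymm.1 hφ) e, map_smul, sign_liftPerm]

theorem wedge_mem {n : ℕ} (f : OneParticle X) {φ : L2n X n} (hφ : φ ∈ antisymm X n) :
    wedge f φ ∈ antisymm X (n + 1) := by
  rw [mem_antisymm]
  intro τ
  rw [wedge_apply, map_sum, Finset.smul_sum]
  refine Fintype.sum_equiv τ _ _ fun j => ?_
  -- `(0 (τ j)) τ (0 j)` fixes `0`
  have h0 : (Equiv.swap 0 (τ j) * (τ * Equiv.swap 0 j)) 0 = 0 := by simp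
  have h := permOp_tensorL_of_apply_zero f hφ h0
  have hdec : τ * Equiv.swap 0 j =
      Equiv.swap 0 (τ j) * (Equiv.swap 0 (τ j) * (τ * Equiv.swap 0 j)) := by
    rw [← mul_assoc, Equiv.swap_mul_self, one_mul]
  rw [map_smul, permOp_mul, hdec, ← permOp_mul, h, map_smul, smul_smul, smul_smul]
  congr 1
  rw [map_mul, map_mul]
  push_cast
  linear_combination ((Equiv.Perm.sign (Equiv.swap 0 (τ j)) : ℤ) : ℂ) *
    ((Equiv.Perm.sign τ : ℤ) : ℂ) * sign_mul_self (Equiv.swap 0 j)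

/-- Every transposition contributes the same amount against an antisymmetric `χ`, so `wedge f` is
`n + 1` times the adjoint of `χ ↦ ∫ conj (f k) χ(k, ·) dk` between antisymmetric functions. -/
theorem inner_wedge {n : ℕ} (f : OneParticle X) (φ : L2n X n) {χ : L2n X (n + 1)}
    (hχ : χ ∈ antisymm X (n + 1)) :
    ⟪χ, wedge f φ⟫_ℂ = (n + 1) * ⟪χ, tensorL f φ⟫_ℂ := by
  rw [wedge_apply, inner_sum]
  have : ∀ j : Fin (n + 1), ⟪χ, ((Equiv.Perm.sign (Equiv.swap 0 j) : ℤ) : ℂ) •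
      permOp X (Equiv.swap 0 j) (tensorL f φ)⟫_ℂ = ⟪χ, tensorL f φ⟫_ℂ := by
    intro j
    have h := permOp_inner (Equiv.swap 0 j)⁻¹ χ (tensorL f φ)
    rw [inv_inv] at h
    rw [inner_smul_right, ← h, Equiv.swap_inv, mem_antisymm.1 hχ, inner_smul_left, ← mul_assoc]
    simp only [map_intCast]
    rw [sign_mul_self, one_mul]
  rw [Finset.sum_congr rfl fun j _ => this j]
  simp

theorem adjoint_permOp_liftPerm {n : ℕ} (g : OneParticle X) (e : Equiv.Perm (Fin n))
    (χ : L2n X (n + 1)) :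
    ContinuousLinearMap.adjoint (tensorL g) (permOp X (liftPerm e) χ) =
      permOp X e (ContinuousLinearMap.adjoint (tensorL g) χ) := by
  refine ext_inner_left ℂ fun η => ?_
  have hi : liftPerm e⁻¹ = (liftPerm e)⁻¹ := by
    refine eq_inv_of_mul_eq_one_left (Equiv.ext fun i => ?_)
    refine Fin.cases ?_ (fun j => ?_) i
    · simp [liftPerm]
    · simp [liftPerm, Equiv.Perm.decomposeFin_symm_apply_succ]
  have h1 := permOp_inner e⁻¹ η (ContinuousLinearMap.adjoint (tensorL g) χ)
  have h2 := permOp_inner (liftPerm e)⁻¹ (tensorL g η) χ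
  rw [inv_inv] at h1 h2
  rw [ContinuousLinearMap.adjoint_inner_right, ← h1, ContinuousLinearMap.adjoint_inner_right,
    ← permOp_tensor, hi, h2]

theorem liftPerm_swap {n : ℕ} (i j : Fin n) :
    liftPerm (Equiv.swap i j) = Equiv.swap i.succ j.succ := by
  ext1 k
  refine Fin.cases ?_ (fun l => ?_) k
  · rw [Equiv.swap_apply_of_ne_of_ne (Fin.succ_ne_zero _).symm (Fin.succ_ne_zero _).symm]
    simp [liftPerm]
  · simp only [liftPerm, Equiv.Perm.decomposeFin_symm_apply_succ, Equiv.swap_self,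
      Equiv.refl_apply]
    exact ((Fin.succ_injective n).map_swap _ _ _)

/-- One-sector form of the canonical anticommutation relation `a(g) a†(f) = ⟪g, f⟫ - a†(f) a(g)`. -/
theorem adjoint_wedge {n : ℕ} (f g : OneParticle X) {φ : L2n X (n + 1)}
    (hφ : φ ∈ antisymm X (n + 1)) :
    ContinuousLinearMap.adjoint (tensorL g) (wedge f φ) =
      ⟪g, f⟫_ℂ • φ - wedge f (ContinuousLinearMap.adjoint (tensorL g) φ) := by
  rw [wedge_apply, Fin.sum_univ_succ, map_add, map_sum, wedge_apply, sub_eq_add_neg,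
    ← Finset.sum_neg_distrib]
  congr 1
  · rw [Equiv.swap_self]
    change ContinuousLinearMap.adjoint (tensorL g)
      (((Equiv.Perm.sign (1 : Equiv.Perm (Fin (n + 2))) : ℤ) : ℂ) • permOp X 1 _) = _
    rw [permOp_one, map_one]
    simp [adjoint_tensorL_tensorL]
  · refine Finset.sum_congr rfl fun j _ => ?_
    -- `(0 j+1) = ρ (0 1) ρ` with `ρ = (1 j+1)` the lift of `(0 j)`
    have hdec : Equiv.swap (0 : Fin (n + 2)) j.succ =
        liftPerm (Equiv.swap 0 j) * (Equiv.swap 0 1 * liftPerm (Equiv.swap 0 j)) := by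
      rw [liftPerm_swap, ← Fin.succ_zero_eq_one]
      have h := Equiv.swap_apply_apply (Equiv.swap (0 : Fin (n + 1)).succ j.succ)
        (0 : Fin (n + 2)) (0 : Fin (n + 1)).succ
      rw [Equiv.swap_apply_left, Equiv.swap_apply_of_ne_of_ne (Fin.succ_ne_zero _).symm
        (Fin.succ_ne_zero _).symm, Equiv.swap_inv] at h
      rw [h, mul_assoc]
    have hs : Equiv.Perm.sign (Equiv.swap (0 : Fin (n + 2)) j.succ) = -1 :=
      Equiv.Perm.sign_swap (Fin.succ_ne_zero _).symm
    rw [map_smul, hs, hdec, ← permOp_mul, ← permOp_mul, permOp_tensor,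
      mem_antisymm.1 hφ, map_smul, map_smul, map_smul, map_smul, adjoint_permOp_liftPerm,
      adjoint_permOp_swap_tensorL]
    simp

theorem adjoint_wedge_zero (f g : OneParticle X) (φ : L2n X 0) :
    ContinuousLinearMap.adjoint (tensorL g) (wedge f φ) = ⟪g, f⟫_ℂ • φ := by
  rw [wedge_apply, Fin.sum_univ_one, Equiv.swap_self]
  change ContinuousLinearMap.adjoint (tensorL g)
    (((Equiv.Perm.sign (1 : Equiv.Perm (Fin 1)) : ℤ) : ℂ) • permOp X 1 _) = _
  rw [permOp_one, map_one]
  simp [adjoint_tensorL_tensorL]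

theorem adjoint_tensorL_anticomm {n : ℕ} (f g : OneParticle X) {ψ : L2n X (n + 2)}
    (hψ : ψ ∈ antisymm X (n + 2)) :
    ContinuousLinearMap.adjoint (tensorL f) (ContinuousLinearMap.adjoint (tensorL g) ψ) =
      -ContinuousLinearMap.adjoint (tensorL g) (ContinuousLinearMap.adjoint (tensorL f) ψ) := by
  refine ext_inner_left ℂ fun η => ?_
  rw [inner_neg_right]
  simp only [ContinuousLinearMap.adjoint_inner_right]
  rw [← permOp_swap_tensorL_tensorL, permOp_inner, Equiv.swap_inv, mem_antisymm.1 hψ,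
    inner_smul_right, Equiv.Perm.sign_swap (by simp)]
  simp

/-! ### The canonical anticommutation relations on Fock space -/

theorem Fock.ext {φ ψ : Fock X} (h : ∀ n, (φ.sector n : L2n X n) = ψ.sector n) : φ = ψ := by
  apply lp.ext
  funext n
  exact Subtype.ext (h n)

@[simp]
theorem Fock.sector_add (φ ψ : Fock X) (n : ℕ) :
    (φ + ψ).sector n = φ.sector n + ψ.sector n := rfl

@[simp]
theorem Fock.sector_smul (c : ℂ) (ψ : Fock X) (n : ℕ) :
    (c • ψ).sector n = c • ψ.sector n := rfl

@[simp]
theorem Fock.sector_zero (n : ℕ) : (0 : Fock X).sector n = 0 := rfl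

/-- The vector of Fock space with `n`-particle component `χ` and no others. -/
noncomputable def Fock.single (n : ℕ) (χ : antisymm X n) : Fock X :=
  show lp (fun n : ℕ => antisymm X n) 2 from lp.single 2 n χ

theorem Fock.sector_single (n : ℕ) (χ : antisymm X n) : (Fock.single n χ).sector n = χ :=
  lp.single_apply_self (E := fun n : ℕ => antisymm X n) 2 n χ

theorem Fock.sector_single_of_ne {m n : ℕ} (h : m ≠ n) (χ : antisymm X n) :
    (Fock.single n χ).sector m = 0 :=
  lp.single_apply_ne (E := fun n : ℕ => antisymm X n) 2 n χ h

theorem Fock.inner_single (n : ℕ) (χ : antisymm X n) (ψ : Fock X) :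
    ⟪Fock.single n χ, ψ⟫_ℂ = ⟪(χ : L2n X n), (ψ.sector n : L2n X n)⟫_ℂ := by
  exact lp.inner_single_left (𝕜 := ℂ) (G := fun n : ℕ => antisymm X n) n χ
    (show lp (fun n : ℕ => antisymm X n) 2 from ψ)

theorem annihilation_sector (f : OneParticle X) (ψ : Fock X) (n : ℕ) :
    ((annihilation f ψ).sector n : L2n X n) = (√((n : ℝ) + 1) : ℂ) •
      ContinuousLinearMap.adjoint (tensorL f) (ψ.sector (n + 1) : L2n X (n + 1)) := by
  apply Lp.ext
  filter_upwards [isAnnihilation_annihilation f ψ n,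
    Lp.coeFn_smul (√((n : ℝ) + 1) : ℂ)
      (ContinuousLinearMap.adjoint (tensorL f) (ψ.sector (n + 1) : L2n X (n + 1))),
    adjoint_tensor_coe f (ψ.sector (n + 1) : L2n X (n + 1))] with x a b c
  rw [a, b, Pi.smul_apply, c, smul_eq_mul]
  rfl

theorem sqrt_succ_mul_self (n : ℕ) : (√((n : ℝ) + 1) : ℂ) * (√((n : ℝ) + 1) : ℂ) = n + 1 := by
  rw [← Complex.ofReal_mul, Real.mul_self_sqrt (by positivity)]
  simp

theorem sqrt_succ_ne_zero (n : ℕ) : (√((n : ℝ) + 1) : ℂ) ≠ 0 :=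
  Complex.ofReal_ne_zero.2 (Real.sqrt_pos.2 (by positivity)).ne'

theorem adjoint_annihilation_sector_zero (f : OneParticle X) (ψ : Fock X) :
    ((ContinuousLinearMap.adjoint (annihilation f) ψ).sector 0 : L2n X 0) = 0 := by
  have h : (ContinuousLinearMap.adjoint (annihilation f) ψ).sector 0 = 0 := by
    refine ext_inner_left ℂ fun χ => ?_
    have h0 : annihilation f (Fock.single 0 χ) = 0 := by
      refine Fock.ext fun n => ?_
      rw [annihilation_sector, Fock.sector_single_of_ne (Nat.succ_ne_zero n)]
      simp
    rw [inner_zero_right]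
    change ⟪(χ : L2n X 0), ((ContinuousLinearMap.adjoint (annihilation f) ψ).sector 0 :
      L2n X 0)⟫_ℂ = 0
    rw [← Fock.inner_single, ContinuousLinearMap.adjoint_inner_right, h0, inner_zero_left]
  rw [h]; rfl

theorem adjoint_annihilation_sector_succ (f : OneParticle X) (ψ : Fock X) (n : ℕ) :
    ((ContinuousLinearMap.adjoint (annihilation f) ψ).sector (n + 1) : L2n X (n + 1)) =
      (√((n : ℝ) + 1) : ℂ)⁻¹ • wedge f (ψ.sector n : L2n X n) := by
  have h : (ContinuousLinearMap.adjoint (annihilation f) ψ).sector (n + 1) =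
      ⟨(√((n : ℝ) + 1) : ℂ)⁻¹ • wedge f (ψ.sector n : L2n X n),
        (antisymm X (n + 1)).smul_mem _ (wedge_mem f (ψ.sector n).2)⟩ := by
    refine ext_inner_left ℂ fun χ => ?_
    have h0 : annihilation f (Fock.single (n + 1) χ) =
        Fock.single n ((annihilation f (Fock.single (n + 1) χ)).sector n) := by
      refine Fock.ext fun m => ?_
      rcases eq_or_ne m n with rfl | hm
      · rw [Fock.sector_single]
      · rw [Fock.sector_single_of_ne hm, annihilation_sector,
          Fock.sector_single_of_ne (fun h => hm (Nat.succ_injective h))]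
        simp
    change ⟪(χ : L2n X (n + 1)), ((ContinuousLinearMap.adjoint (annihilation f) ψ).sector (n + 1) :
      L2n X (n + 1))⟫_ℂ = ⟪(χ : L2n X (n + 1)), (√((n : ℝ) + 1) : ℂ)⁻¹ • wedge f (ψ.sector n)⟫_ℂ
    rw [← Fock.inner_single, ContinuousLinearMap.adjoint_inner_right, h0, Fock.inner_single,
      annihilation_sector, Fock.sector_single, inner_smul_left, Complex.conj_ofReal,
      ContinuousLinearMap.adjoint_inner_left, inner_smul_right, inner_wedge f _ χ.2,
      ← sqrt_succ_mul_self]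
    field_simp [sqrt_succ_ne_zero n]
  rw [h]

theorem annihilation_add (f g : OneParticle X) :
    annihilation (f + g) = annihilation f + annihilation g := by
  ext1 ψ
  refine Fock.ext fun n => ?_
  rw [add_apply, Fock.sector_add, Submodule.coe_add, annihilation_sector,
    annihilation_sector, annihilation_sector, tensorL_add, map_add, add_apply,
    smul_add]

theorem annihilation_smul (c : ℂ) (f : OneParticle X) :
    annihilation (c • f) = (starRingEnd ℂ) c • annihilation f := by
  ext1 ψ
  refine Fock.ext fun n => ?_
  rw [smul_apply, Fock.sector_smul, Submodule.coe_smul, annihilation_sector,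
    annihilation_sector, tensorL_smul, map_smulₛₗ, smul_apply, smul_comm]

theorem norm_annihilation_le (f : OneParticle X) : ‖annihilation f‖ ≤ ‖f‖ :=
  (Classical.choose_spec (exists_annihilation f)).2

theorem annihilation_anticomm (f g : OneParticle X) :
    annihilation f * annihilation g + annihilation g * annihilation f = 0 := by
  ext1 ψ
  refine Fock.ext fun n => ?_
  rw [add_apply, Fock.sector_add, Submodule.coe_add]
  simp only [mul_apply_eq_comp, annihilation_sector, map_smul]
  rw [adjoint_tensorL_anticomm f g (ψ.sector (n + 2)).2]
  simp

/-- The factors `√(n + 1)` of `a(g)` and `1/√(n + 1)` of `a†(f)` cancel, and `adjoint_wedge`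
remains. -/
theorem annihilation_adjoint_anticomm (f g : OneParticle X) :
    annihilation g * ContinuousLinearMap.adjoint (annihilation f) +
      ContinuousLinearMap.adjoint (annihilation f) * annihilation g = ⟪g, f⟫_ℂ • 1 := by
  ext1 ψ
  refine Fock.ext fun n => ?_
  rw [add_apply, Fock.sector_add, Submodule.coe_add]
  simp only [mul_apply_eq_comp, smul_apply,
    one_apply_eq_self, Fock.sector_smul, Submodule.coe_smul]
  rw [annihilation_sector, adjoint_annihilation_sector_succ, map_smul, smul_smul,
    mul_inv_cancel₀ (sqrt_succ_ne_zero n), one_smul]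
  cases n with
  | zero => rw [adjoint_wedge_zero, adjoint_annihilation_sector_zero, add_zero]
  | succ n =>
    rw [adjoint_wedge f g (ψ.sector (n + 1)).2, adjoint_annihilation_sector_succ,
      annihilation_sector, map_smul, smul_smul, inv_mul_cancel₀ (sqrt_succ_ne_zero n), one_smul,
      sub_add_cancel]

theorem nontrivial_fock : Nontrivial (Fock X) := by
  have hμ : (volume : Measure (Fin 0 → X)) Set.univ = 1 := by
    rw [volume_pi, Measure.pi_univ]; simp
  have hne : (volume : Measure (Fin 0 → X)) Set.univ ≠ ⊤ := by rw [hμ]; simp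
  -- the vacuum, the constant function `1` of no variables
  let v : L2n X 0 := indicatorConstLp 2 MeasurableSet.univ hne (1 : ℂ)
  have hv : ‖v‖ = 1 := by
    simp only [v]
    rw [norm_indicatorConstLp (by norm_num) (by norm_num)]
    simp [Measure.real, hμ]
  have hmem : v ∈ antisymm X 0 := by
    rw [mem_antisymm]
    intro σ
    rw [Subsingleton.elim σ 1, permOp_one]
    simp
  refine ⟨⟨Fock.single 0 ⟨v, hmem⟩, 0, fun h => ?_⟩⟩
  have h1 := congrArg (fun ψ : Fock X => ‖(ψ.sector 0 : L2n X 0)‖) h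
  simp only [Fock.sector_single, Fock.sector_zero, Submodule.coe_zero, norm_zero, hv] at h1
  exact one_ne_zero h1

end FockSpace

section CARAlgebra

variable {X : Type*} [MeasureSpace X] [SigmaFinite (volume : Measure X)]

/-! ### The CAR algebra -/

/-- The inclusion of the CAR algebra into the bounded operators on Fock space. -/
noncomputable def CAR.toOp (X : Type*) [MeasureSpace X] [SigmaFinite (volume : Measure X)] :
    CAR X →⋆ₐ[ℂ] (Fock X →L[ℂ] Fock X) :=
  (carAlgebra X).subtype

theorem CAR.toOp_injective : Function.Injective (CAR.toOp X) :=
  Subtype.val_injective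

theorem CAR.toOp_ann (f : OneParticle X) : CAR.toOp X (ann f) = annihilation f := rfl

theorem CAR.toOp_cre (f : OneParticle X) :
    CAR.toOp X (cre f) = ContinuousLinearMap.adjoint (annihilation f) := by
  rw [cre, map_star, CAR.toOp_ann]; rfl

instance instNontrivialCAR : Nontrivial (CAR X) := by
  have : Nontrivial (Fock X) := nontrivial_fock
  refine ⟨⟨1, 0, fun h => ?_⟩⟩
  have := congrArg (CAR.toOp X) h
  rw [map_one, map_zero] at this
  exact one_ne_zero this

theorem ann_add (f g : OneParticle X) : ann (f + g) = ann f + ann g :=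
  CAR.toOp_injective (by rw [map_add]; exact annihilation_add f g)

theorem ann_smul (c : ℂ) (f : OneParticle X) : ann (c • f) = (starRingEnd ℂ) c • ann f :=
  CAR.toOp_injective (by rw [map_smul]; exact annihilation_smul c f)

theorem norm_ann_le (f : OneParticle X) : ‖ann f‖ ≤ ‖f‖ := norm_annihilation_le f

/-- `f ↦ a(f)` as a continuous antilinear map. -/
noncomputable def annL (X : Type*) [MeasureSpace X] [SigmaFinite (volume : Measure X)] :
    OneParticle X →L⋆[ℂ] CAR X :=
  LinearMap.mkContinuous
    { toFun := ann
      map_add' := ann_add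
      map_smul' := ann_smul } 1 fun f => by rw [one_mul]; exact norm_ann_le f

@[simp]
theorem annL_apply (f : OneParticle X) : annL X f = ann f := rfl

@[simp]
theorem star_ann (f : OneParticle X) : star (ann f) = cre f := rfl

@[simp]
theorem star_cre (f : OneParticle X) : star (cre f) = ann f := star_star _

theorem ann_mul_ann (f g : OneParticle X) : ann f * ann g = -(ann g * ann f) := by
  rw [eq_neg_iff_add_eq_zero]
  exact CAR.toOp_injective (by
    rw [map_add, map_mul, map_mul, map_zero]; exact annihilation_anticomm f g)

theorem cre_mul_cre (f g : OneParticle X) : cre f * cre g = -(cre g * cre f) := by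
  have h := congrArg star (ann_mul_ann g f)
  simpa using h

theorem ann_mul_cre (g f : OneParticle X) : ann g * cre f = ⟪g, f⟫_ℂ • 1 - cre f * ann g := by
  rw [eq_sub_iff_add_eq]
  exact CAR.toOp_injective (by
    rw [map_add, map_mul, map_mul, map_smul, map_one, CAR.toOp_cre]
    exact annihilation_adjoint_anticomm f g)

theorem ann_mul_self (f : OneParticle X) : ann f * ann f = 0 := by
  have h : (2 : ℂ) • (ann f * ann f) = 0 := by
    rw [two_smul]; nth_rw 1 [ann_mul_ann]; exact neg_add_cancel _
  exact (smul_eq_zero.1 h).resolve_left two_ne_zero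

theorem cre_mul_self (f : OneParticle X) : cre f * cre f = 0 := by
  have h : (2 : ℂ) • (cre f * cre f) = 0 := by
    rw [two_smul]; nth_rw 1 [cre_mul_cre]; exact neg_add_cancel _
  exact (smul_eq_zero.1 h).resolve_left two_ne_zero

/-! ### The average over the unitaries of one mode -/

/-- The map `A ↦ ¼ ∑_α u_α* A u_α`. -/
noncomputable def average (u : Fin 4 → CAR X) : CAR X →L[ℂ] CAR X :=
  (4 : ℂ)⁻¹ • ∑ α, (ContinuousLinearMap.mul ℂ (CAR X) (star (u α))) ∘L
    ((ContinuousLinearMap.mul ℂ (CAR X)).flip (u α))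

theorem average_apply (u : Fin 4 → CAR X) (A : CAR X) :
    average u A = (4 : ℂ)⁻¹ • ∑ α, star (u α) * A * u α := by
  simp [average, mul_assoc]

theorem norm_unitary_conj {u : CAR X} (hu : u ∈ unitary (CAR X)) (A : CAR X) :
    ‖star u * A * u‖ = ‖A‖ := by
  rw [CStarRing.norm_mul_mem_unitary _ hu,
    CStarRing.norm_mem_unitary_mul _ (Unitary.star_mem hu)]

theorem norm_average_le {u : Fin 4 → CAR X} (hu : ∀ α, u α ∈ unitary (CAR X)) (A : CAR X) :
    ‖average u A‖ ≤ ‖A‖ := by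
  rw [average_apply, norm_smul]
  have h : ‖∑ α, star (u α) * A * u α‖ ≤ 4 * ‖A‖ := by
    refine (norm_sum_le _ _).trans ?_
    rw [Finset.sum_congr rfl fun α _ => norm_unitary_conj (hu α) A]
    simp
  calc _ ≤ ‖(4 : ℂ)⁻¹‖ * (4 * ‖A‖) := by gcongr
    _ = ‖A‖ := by norm_num; ring

theorem average_eq_self {u : Fin 4 → CAR X} (hu : ∀ α, u α ∈ unitary (CAR X)) {A : CAR X}
    (hA : ∀ α, Commute A (u α)) : average u A = A := by
  have h : ∀ α, star (u α) * A * u α = A := fun α => by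
    rw [mul_assoc, (hA α).eq, ← mul_assoc, Unitary.star_mul_self_of_mem (hu α), one_mul]
  rw [average_apply, Finset.sum_congr rfl fun α _ => h α]
  simp [← Nat.cast_smul_eq_nsmul ℂ, smul_smul]

theorem average_average (u v : Fin 4 → CAR X) (A : CAR X) :
    average u (average v A) =
      (4 : ℂ)⁻¹ • (4 : ℂ)⁻¹ • ∑ α, ∑ β, star (v β * u α) * A * (v β * u α) := by
  rw [average_apply, average_apply]
  simp only [mul_smul_comm, smul_mul_assoc, ← Finset.smul_sum]
  congr 2
  refine Finset.sum_congr rfl fun α _ => ?_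
  rw [Finset.mul_sum, Finset.sum_mul]
  refine Finset.sum_congr rfl fun β _ => ?_
  simp only [star_mul, mul_assoc]

/-- Averages over families that commute up to signs commute. -/
theorem average_commute {u v : Fin 4 → CAR X}
    (h : ∀ α β, u α * v β = v β * u α ∨ u α * v β = -(v β * u α)) :
    Commute (average u) (average v) := by
  refine ContinuousLinearMap.ext fun A => ?_
  have e : ∀ α β, star (v β * u α) * A * (v β * u α) = star (u α * v β) * A * (u α * v β) := by
    intro α β
    rcases h α β with h | h
    · rw [h]
    · rw [h, star_neg, neg_mul, neg_mul, mul_neg, neg_neg]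
  rw [mul_apply_eq_comp, mul_apply_eq_comp, average_average, average_average, Finset.sum_comm]
  simp only [e]

section Mode

variable {h : OneParticle X} (hh : ‖h‖ = 1)
include hh

theorem ann_mul_cre_self : ann h * cre h = 1 - cre h * ann h := by
  rw [ann_mul_cre, inner_self_eq_norm_sq_to_K, hh]
  simp

theorem ann_mul_cre_mul_ann : ann h * (cre h * ann h) = ann h := by
  rw [← mul_assoc, ann_mul_cre_self hh, sub_mul, mul_assoc, ann_mul_self]
  simp

theorem cre_mul_ann_mul_cre : cre h * (ann h * cre h) = cre h := by
  rw [ann_mul_cre_self hh, mul_sub, ← mul_assoc, cre_mul_self]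
  simp

theorem kraus_mem_unitary (α : Fin 4) : kraus h α ∈ unitary (CAR X) := by
  have h1 := ann_mul_cre_self hh
  have h2 := ann_mul_self h
  have h3 := cre_mul_self h
  have h4 : cre h * ann h * (cre h * ann h) = cre h * ann h := by
    rw [mul_assoc, ann_mul_cre_mul_ann hh]
  rw [Unitary.mem_iff]
  fin_cases α <;> simp only [kraus, Fin.mk_zero, Fin.mk_one, Fin.reduceFinMk, Matrix.cons_val,
    star_one, star_add, star_sub, star_mul, star_ann, star_cre, star_ofNat]
  · simp
  · constructor <;> noncomm_ring [h1, h2, h3]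
  · constructor <;> noncomm_ring [h1, h2, h3]
  · constructor <;>
    · simp only [mul_sub, sub_mul, mul_one, one_mul, mul_assoc, two_mul, mul_two, add_mul,
        mul_add]
      simp only [ann_mul_cre_mul_ann hh]
      abel

/-- The average over the four unitaries of a mode in terms of `a(h)` and `a†(h)`. -/
theorem average_kraus (A : CAR X) :
    average (kraus h) A = (2 : ℂ)⁻¹ • (ann h * (cre h * (A * (ann h * cre h))) +
      cre h * (ann h * (A * (cre h * ann h))) + cre h * (A * ann h) + ann h * (A * cre h)) := by
  have h1 := ann_mul_cre_self hh
  have e : ∑ α, star (kraus h α) * A * kraus h α =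
      (2 : ℂ) • (ann h * (cre h * (A * (ann h * cre h))) +
      cre h * (ann h * (A * (cre h * ann h))) + cre h * (A * ann h) + ann h * (A * cre h)) := by
    rw [← mul_assoc (ann h) (cre h), h1, Fin.sum_univ_four]
    simp only [kraus, Matrix.cons_val,
      star_one, star_add, star_sub, star_mul, star_ann, star_cre, star_ofNat, two_smul]
    noncomm_ring
  rw [average_apply, e, smul_smul]
  norm_num

/-- Both sides equal `½ (a†a A a + a A a a†)`, up to the order of the two terms. -/
theorem average_kraus_ann_mul (A : CAR X) :
    average (kraus h) (ann h * A) = average (kraus h) (A * ann h) := by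
  have h2 := ann_mul_self h
  have h2' : ∀ B, ann h * (ann h * B) = 0 := fun B => by rw [← mul_assoc, h2, zero_mul]
  have h4 := ann_mul_cre_mul_ann hh
  have h4' : ∀ B, ann h * (cre h * (ann h * B)) = ann h * B := fun B => by
    rw [← mul_assoc (cre h), ← mul_assoc (ann h), h4]
  rw [average_kraus hh, average_kraus hh]
  simp only [mul_assoc, h2, h2', h4, h4', mul_zero, zero_add, add_zero]
  rw [add_comm]

theorem average_kraus_cre_mul (A : CAR X) :
    average (kraus h) (cre h * A) = average (kraus h) (A * cre h) := by
  have h3 := cre_mul_self h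
  have h3' : ∀ B, cre h * (cre h * B) = 0 := fun B => by rw [← mul_assoc, h3, zero_mul]
  have h5 := cre_mul_ann_mul_cre hh
  have h5' : ∀ B, cre h * (ann h * (cre h * B)) = cre h * B := fun B => by
    rw [← mul_assoc (ann h), ← mul_assoc (cre h), h5]
  rw [average_kraus hh, average_kraus hh]
  simp only [mul_assoc, h3, h3', h5, h5', mul_zero, zero_add, add_zero]
  rw [add_comm]

theorem average_kraus_commute_ann (A : CAR X) : Commute (average (kraus h) A) (ann h) := by
  have h2 := ann_mul_self h
  have h2' : ∀ B, ann h * (ann h * B) = 0 := fun B => by rw [← mul_assoc, h2, zero_mul]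
  have h4 := ann_mul_cre_mul_ann hh
  have h4' : ∀ B, ann h * (cre h * (ann h * B)) = ann h * B := fun B => by
    rw [← mul_assoc (cre h), ← mul_assoc (ann h), h4]
  change _ * _ = _ * _
  rw [average_kraus hh]
  simp only [smul_mul_assoc, mul_smul_comm, add_mul, mul_add, mul_assoc, h2, h2', h4, h4',
    mul_zero, zero_add, add_zero]
  rw [add_comm]

theorem average_kraus_commute_cre (A : CAR X) : Commute (average (kraus h) A) (cre h) := by
  have h3 := cre_mul_self h
  have h3' : ∀ B, cre h * (cre h * B) = 0 := fun B => by rw [← mul_assoc, h3, zero_mul]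
  have h5 := cre_mul_ann_mul_cre hh
  have h5' : ∀ B, cre h * (ann h * (cre h * B)) = cre h * B := fun B => by
    rw [← mul_assoc (ann h), ← mul_assoc (cre h), h5]
  change _ * _ = _ * _
  rw [average_kraus hh]
  simp only [smul_mul_assoc, mul_smul_comm, add_mul, mul_add, mul_assoc, h3, h3', h5, h5',
    mul_zero, zero_add, add_zero]
  rw [add_comm]

omit hh in
theorem commute_kraus {A : CAR X} (h1 : Commute A (ann h)) (h2 : Commute A (cre h)) (α : Fin 4) :
    Commute A (kraus h α) := by
  fin_cases α
  · exact Commute.one_right A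
  · exact h2.add_right h1
  · exact h2.sub_right h1
  · exact (Commute.one_right A).sub_right
      ((Commute.ofNat_right A 2).mul_right (h2.mul_right h1))

theorem average_kraus_eq_self {A : CAR X} (h1 : Commute A (ann h)) (h2 : Commute A (cre h)) :
    average (kraus h) A = A :=
  average_eq_self (kraus_mem_unitary hh) (commute_kraus h1 h2)

/-- The average over a mode kills operators that anticommute with the mode. -/
theorem average_kraus_eq_zero {A : CAR X} (h1 : A * ann h = -(ann h * A))
    (h2 : A * cre h = -(cre h * A)) : average (kraus h) A = 0 := by
  have e2 := ann_mul_self h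
  have e2' : ∀ B, ann h * (ann h * B) = 0 := fun B => by rw [← mul_assoc, e2, zero_mul]
  have e3 := cre_mul_self h
  have e3' : ∀ B, cre h * (cre h * B) = 0 := fun B => by rw [← mul_assoc, e3, zero_mul]
  have h1' : ∀ B, A * (ann h * B) = -(ann h * (A * B)) := fun B => by
    rw [← mul_assoc, h1, neg_mul, mul_assoc]
  have h2' : ∀ B, A * (cre h * B) = -(cre h * (A * B)) := fun B => by
    rw [← mul_assoc, h2, neg_mul, mul_assoc]
  have h4 := ann_mul_cre_mul_ann hh
  have h4' : ∀ B, ann h * (cre h * (ann h * B)) = ann h * B := fun B => by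
    rw [← mul_assoc (cre h), ← mul_assoc (ann h), h4]
  have h5 := cre_mul_ann_mul_cre hh
  have h5' : ∀ B, cre h * (ann h * (cre h * B)) = cre h * B := fun B => by
    rw [← mul_assoc (ann h), ← mul_assoc (cre h), h5]
  rw [average_kraus hh]
  simp only [h1, h2, h1', h2', mul_neg, neg_neg, h4', h5']
  simp

/-- For `A` commuting with the mode, averaging replaces `a†(h) a(h)` by `½`. -/
theorem average_kraus_mul_number {A : CAR X} (h1 : Commute A (ann h)) (h2 : Commute A (cre h)) :
    average (kraus h) (A * (cre h * ann h)) = (2 : ℂ)⁻¹ • A := by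
  have e2 := ann_mul_self h
  have e2' : ∀ B, ann h * (ann h * B) = 0 := fun B => by rw [← mul_assoc, e2, zero_mul]
  have h1' : ∀ B, ann h * (A * B) = A * (ann h * B) := fun B => by
    rw [← mul_assoc, ← h1.eq, mul_assoc]
  have h2' : ∀ B, cre h * (A * B) = A * (cre h * B) := fun B => by
    rw [← mul_assoc, ← h2.eq, mul_assoc]
  have h4 := ann_mul_cre_mul_ann hh
  have h4' : ∀ B, ann h * (cre h * (ann h * B)) = ann h * B := fun B => by
    rw [← mul_assoc (cre h), ← mul_assoc (ann h), h4]
  rw [average_kraus hh]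
  simp only [mul_assoc, h1', h2', h4', h4, e2, e2', mul_zero, zero_add, add_zero]
  rw [← mul_add, ann_mul_cre_self hh]
  simp

/-- `1 - 2 a†(h) a(h)` is an involution. -/
theorem kraus_three_mul_self : kraus h 3 * kraus h 3 = 1 := by
  change (1 - 2 * (cre h * ann h)) * (1 - 2 * (cre h * ann h)) = 1
  simp only [mul_sub, sub_mul, mul_one, one_mul, mul_assoc, two_mul, add_mul, mul_add]
  simp only [ann_mul_cre_mul_ann hh]
  abel

theorem kraus_three_mul_ann : kraus h 3 * ann h = -(ann h * kraus h 3) := by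
  change (1 - 2 * (cre h * ann h)) * ann h = -(ann h * (1 - 2 * (cre h * ann h)))
  simp only [mul_sub, sub_mul, mul_one, one_mul, mul_assoc, two_mul, add_mul, mul_add,
    ann_mul_cre_mul_ann hh, ann_mul_self, mul_zero]
  abel

theorem kraus_three_mul_cre : kraus h 3 * cre h = -(cre h * kraus h 3) := by
  have e3' : ∀ B, cre h * (cre h * B) = 0 := fun B => by rw [← mul_assoc, cre_mul_self, zero_mul]
  change (1 - 2 * (cre h * ann h)) * cre h = -(cre h * (1 - 2 * (cre h * ann h)))
  simp only [mul_sub, sub_mul, mul_one, one_mul, mul_assoc, two_mul, add_mul, mul_add,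
    cre_mul_ann_mul_cre hh, e3']
  abel

end Mode

end CARAlgebra

section Words

variable {X : Type*} [MeasureSpace X] [SigmaFinite (volume : Measure X)]

/-! ### Words in creation and annihilation operators -/

/-- The creation and annihilation operators of the vectors in `T`. -/
def letters (T : Set (OneParticle X)) : Set (CAR X) := ann '' T ∪ cre '' T

theorem ann_mem_letters {T : Set (OneParticle X)} {f : OneParticle X} (hf : f ∈ T) :
    ann f ∈ letters T :=
  Or.inl ⟨f, hf, rfl⟩

theorem cre_mem_letters {T : Set (OneParticle X)} {f : OneParticle X} (hf : f ∈ T) :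
    cre f ∈ letters T :=
  Or.inr ⟨f, hf, rfl⟩

theorem letters_mono {S T : Set (OneParticle X)} (h : S ⊆ T) : letters S ⊆ letters T :=
  Set.union_subset_union (Set.image_mono h) (Set.image_mono h)

theorem letters_union (S T : Set (OneParticle X)) :
    letters (S ∪ T) = letters S ∪ letters T := by
  simp only [letters, Set.image_union]
  ac_rfl

theorem star_mem_letters {T : Set (OneParticle X)} {x : CAR X} (hx : x ∈ letters T) :
    star x ∈ letters T := by
  rcases hx with ⟨f, hf, rfl⟩ | ⟨f, hf, rfl⟩
  · exact Or.inr ⟨f, hf, rfl⟩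
  · exact Or.inl ⟨f, hf, by simp⟩

theorem exists_anticomm_eq_smul_one {S T : Set (OneParticle X)} {x y : CAR X} (hx : x ∈ letters S)
    (hy : y ∈ letters T) : ∃ c : ℂ, x * y = c • 1 - y * x := by
  rcases hx with ⟨f, -, rfl⟩ | ⟨f, -, rfl⟩ <;> rcases hy with ⟨g, -, rfl⟩ | ⟨g, -, rfl⟩
  · exact ⟨0, by rw [ann_mul_ann]; simp⟩
  · exact ⟨_, ann_mul_cre f g⟩
  · exact ⟨⟪g, f⟫_ℂ, by rw [ann_mul_cre]; simp⟩
  · exact ⟨0, by rw [cre_mul_cre]; simp⟩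

theorem letters_anticomm {S T : Set (OneParticle X)} (h : ∀ f ∈ S, ∀ g ∈ T, ⟪f, g⟫_ℂ = 0)
    {x y : CAR X} (hx : x ∈ letters S) (hy : y ∈ letters T) : x * y = -(y * x) := by
  rcases hx with ⟨f, hf, rfl⟩ | ⟨f, hf, rfl⟩ <;> rcases hy with ⟨g, hg, rfl⟩ | ⟨g, hg, rfl⟩
  · exact ann_mul_ann f g
  · rw [ann_mul_cre, h f hf g hg]; simp
  · rw [ann_mul_cre, inner_eq_zero_symm.1 (h f hf g hg)]; simp
  · exact cre_mul_cre f g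

/-- An operator that anticommutes with all letters of a word commutes with it up to the parity of
the word. -/
theorem mul_prod_of_anticomm {x : CAR X} (l : List (CAR X)) (h : ∀ y ∈ l, x * y = -(y * x)) :
    x * l.prod = (-1 : ℂ) ^ l.length • (l.prod * x) := by
  induction l with
  | nil => simp
  | cons y l ih =>
    rw [List.prod_cons, ← mul_assoc, h y (by simp), neg_mul, mul_assoc,
      ih fun z hz => h z (by simp [hz]), List.length_cons, pow_succ, mul_smul_comm, mul_assoc]
    simp

/-- The span of the words in the letters of `T` that have one letter less than `n`. -/
noncomputable def shortWords (T : Set (OneParticle X)) (n : ℕ) : Submodule ℂ (CAR X) :=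
  Submodule.span ℂ {A | ∃ l : List (CAR X), l.length + 1 = n ∧ (∀ B ∈ l, B ∈ letters T) ∧
    A = l.prod}

theorem prod_mem_shortWords {T : Set (OneParticle X)} {l : List (CAR X)}
    (h : ∀ B ∈ l, B ∈ letters T) : l.prod ∈ shortWords T (l.length + 1) :=
  Submodule.subset_span ⟨l, rfl, h, rfl⟩

theorem mul_prod_mem_shortWords {T : Set (OneParticle X)} {n : ℕ} {r : CAR X}
    (hr : r ∈ shortWords T n) {l : List (CAR X)} (h : ∀ B ∈ l, B ∈ letters T) :
    r * l.prod ∈ shortWords T (n + l.length) := by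
  induction hr using Submodule.span_induction with
  | mem r hr =>
    obtain ⟨l', rfl, hl', rfl⟩ := hr
    rw [← List.prod_append]
    refine Submodule.subset_span ⟨l' ++ l, by simp; ring, fun B hB => ?_, rfl⟩
    exact (List.mem_append.1 hB).elim (hl' B) (h B)
  | zero => simp
  | add a b _ _ ha hb => rw [add_mul]; exact add_mem ha hb
  | smul c a _ ha => rw [smul_mul_assoc]; exact Submodule.smul_mem _ c ha

theorem prod_mul_mem_shortWords {T : Set (OneParticle X)} {n : ℕ} {r : CAR X}
    (hr : r ∈ shortWords T n) {l : List (CAR X)} (h : ∀ B ∈ l, B ∈ letters T) :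
    l.prod * r ∈ shortWords T (l.length + n) := by
  induction hr using Submodule.span_induction with
  | mem r hr =>
    obtain ⟨l', rfl, hl', rfl⟩ := hr
    rw [← List.prod_append]
    refine Submodule.subset_span ⟨l ++ l', by simp; ring, fun B hB => ?_, rfl⟩
    exact (List.mem_append.1 hB).elim (h B) (hl' B)
  | zero => simp
  | add a b _ _ ha hb => rw [mul_add]; exact add_mem ha hb
  | smul c a _ ha => rw [mul_smul_comm]; exact Submodule.smul_mem _ c ha

/-- Moving a letter through a word produces, besides the sign, only words with one letter less
than the given one. -/
theorem exists_mul_prod_eq {T : Set (OneParticle X)} {x : CAR X} (hx : x ∈ letters T)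
    (l : List (CAR X)) (h : ∀ B ∈ l, B ∈ letters T) :
    ∃ r ∈ shortWords T l.length, x * l.prod = (-1 : ℂ) ^ l.length • (l.prod * x) + r := by
  induction l with
  | nil => exact ⟨0, zero_mem _, by simp⟩
  | cons y l ih =>
    have hl : ∀ B ∈ l, B ∈ letters T := fun B hB => h B (by simp [hB])
    obtain ⟨r, hr, e⟩ := ih hl
    obtain ⟨c, hc⟩ := exists_anticomm_eq_smul_one hx (h y (by simp))
    refine ⟨c • l.prod - y * r, sub_mem (Submodule.smul_mem _ c (prod_mem_shortWords hl)) ?_, ?_⟩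
    · have := prod_mul_mem_shortWords (l := [y]) hr (by simpa using h y (by simp))
      simpa [add_comm] using this
    · rw [List.prod_cons, ← mul_assoc, hc, sub_mul, mul_assoc, e, List.length_cons, pow_succ,
        mul_add, mul_smul_comm, mul_assoc]
      simp
      abel

theorem even_prod_mem {T : Set (OneParticle X)} {l : List (CAR X)} (hl : Even l.length)
    (h : ∀ B ∈ l, B ∈ letters T) : l.prod ∈ evenMonomials T :=
  ⟨l, hl, h, rfl⟩

theorem one_mem_evenMonomials (T : Set (OneParticle X)) : 1 ∈ evenMonomials T :=
  ⟨[], by simp, by simp, by simp⟩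

theorem mul_mem_evenMonomials {T : Set (OneParticle X)} {A B : CAR X} (hA : A ∈ evenMonomials T)
    (hB : B ∈ evenMonomials T) : A * B ∈ evenMonomials T := by
  obtain ⟨l, hl, hl', rfl⟩ := hA
  obtain ⟨m, hm, hm', rfl⟩ := hB
  refine ⟨l ++ m, by rw [List.length_append]; exact hl.add hm, fun B hB => ?_, by simp⟩
  exact (List.mem_append.1 hB).elim (hl' B) (hm' B)

theorem star_list_prod (l : List (CAR X)) : star l.prod = (l.map star).reverse.prod := by
  induction l with
  | nil => simp
  | cons x l ih => simp [ih]

theorem star_mem_evenMonomials {T : Set (OneParticle X)} {A : CAR X}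
    (hA : A ∈ evenMonomials T) : star A ∈ evenMonomials T := by
  obtain ⟨l, hl, hl', rfl⟩ := hA
  refine ⟨(l.map star).reverse, by simpa using hl, fun B hB => ?_, star_list_prod l⟩
  simp only [List.mem_reverse, List.mem_map] at hB
  obtain ⟨C, hC, rfl⟩ := hB
  exact star_mem_letters (hl' C hC)

theorem evenMonomials_mono {S T : Set (OneParticle X)} (h : S ⊆ T) :
    evenMonomials S ⊆ evenMonomials T := by
  rintro _ ⟨l, hl, hl', rfl⟩
  exact ⟨l, hl, fun B hB => letters_mono h (hl' B hB), rfl⟩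

theorem evenCAR_mono {S T : Set (OneParticle X)} (h : S ⊆ T) : evenCAR S ≤ evenCAR T :=
  StarSubalgebra.topologicalClosure_mono (StarAlgebra.adjoin_mono (evenMonomials_mono h))

theorem adjoin_evenMonomials (T : Set (OneParticle X)) :
    (StarAlgebra.adjoin ℂ (evenMonomials T) : Set (CAR X)) =
      Submodule.span ℂ (evenMonomials T) := by
  have h : Subalgebra.toSubmodule (StarAlgebra.adjoin ℂ (evenMonomials T)).toSubalgebra =
      Submodule.span ℂ (evenMonomials T) := by
    let P : Submonoid (CAR X) :=
      { carrier := evenMonomials T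
        mul_mem' := mul_mem_evenMonomials
        one_mem' := one_mem_evenMonomials T }
    have hs : evenMonomials T ∪ star (evenMonomials T) = (P : Set (CAR X)) := by
      refine Set.union_eq_left.2 fun A hA => ?_
      have := star_mem_evenMonomials hA
      rwa [star_star] at this
    rw [StarAlgebra.adjoin_toSubalgebra, hs, Algebra.adjoin_eq_span, Submonoid.closure_eq]
    rfl
  rw [← h]; rfl

theorem mem_evenCAR_iff {T : Set (OneParticle X)} {A : CAR X} :
    A ∈ evenCAR T ↔ A ∈ closure (Submodule.span ℂ (evenMonomials T) : Set (CAR X)) := by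
  rw [← adjoin_evenMonomials]; rfl

theorem adjoin_ann (T : Set (OneParticle X)) :
    (StarAlgebra.adjoin ℂ (ann '' T) : Set (CAR X)) =
      Submodule.span ℂ {A | ∃ l : List (CAR X), (∀ B ∈ l, B ∈ letters T) ∧ A = l.prod} := by
  have h : Subalgebra.toSubmodule (StarAlgebra.adjoin ℂ (ann '' T)).toSubalgebra =
      Submodule.span ℂ {A | ∃ l : List (CAR X), (∀ B ∈ l, B ∈ letters T) ∧ A = l.prod} := by
    have hs : ann '' T ∪ star (ann '' T) = letters T := by
      rw [letters]
      congr 1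
      ext A
      rw [Set.mem_star]
      constructor
      · rintro ⟨f, hf, e⟩
        exact ⟨f, hf, by rw [← star_ann, e, star_star]⟩
      · rintro ⟨f, hf, rfl⟩
        exact ⟨f, hf, by simp⟩
    rw [StarAlgebra.adjoin_toSubalgebra, hs, Algebra.adjoin_eq_span]
    congr 1
    ext A
    constructor
    · intro hA
      obtain ⟨l, hl, e⟩ := Submonoid.exists_list_of_mem_closure hA
      exact ⟨l, hl, e.symm⟩
    · rintro ⟨l, hl, rfl⟩
      exact list_prod_mem fun B hB => Submonoid.subset_closure (hl B hB)
  rw [← h]; rfl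

theorem mem_subCAR_iff {T : Set (OneParticle X)} {A : CAR X} :
    A ∈ subCAR T ↔ A ∈ closure (Submodule.span ℂ
      {A | ∃ l : List (CAR X), (∀ B ∈ l, B ∈ letters T) ∧ A = l.prod} : Set (CAR X)) := by
  rw [← adjoin_ann]; rfl

theorem ann_mem_subCAR {T : Set (OneParticle X)} {f : OneParticle X}
    (hf : f ∈ (Submodule.span ℂ T).topologicalClosure) : ann f ∈ subCAR T := by
  have hc : IsClosed (subCAR T : Set (CAR X)) := StarSubalgebra.isClosed_topologicalClosure _
  have h1 : ∀ g ∈ Submodule.span ℂ T, ann g ∈ subCAR T := by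
    intro g hg
    induction hg using Submodule.span_induction with
    | mem g hg =>
      exact StarSubalgebra.le_topologicalClosure _
        (StarAlgebra.subset_adjoin ℂ _ (Set.mem_image_of_mem _ hg))
    | zero => rw [← annL_apply, map_zero]; exact zero_mem _
    | add a b _ _ ha hb => rw [ann_add]; exact add_mem ha hb
    | smul c a _ ha => rw [ann_smul]; exact SMulMemClass.smul_mem _ ha
  exact closure_minimal (t := annL X ⁻¹' (subCAR T : Set (CAR X))) (fun g hg => h1 g hg)
    (hc.preimage (annL X).continuous) hf

/-- The CAR algebra is generated by the annihilation operators of any total set of vectors. -/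
theorem mem_subCAR_of_total {T : Set (OneParticle X)}
    (hT : (Submodule.span ℂ T).topologicalClosure = ⊤) (A : CAR X) : A ∈ subCAR T := by
  have hc : IsClosed (subCAR T : Set (CAR X)) := StarSubalgebra.isClosed_topologicalClosure _
  have h1 : StarAlgebra.adjoin ℂ (Set.range (ann (X := X))) ≤ subCAR T := by
    rw [StarAlgebra.adjoin_le_iff]
    rintro _ ⟨f, rfl⟩
    exact ann_mem_subCAR (hT ▸ Submodule.mem_top)
  have h2 : A ∈ closure (StarAlgebra.adjoin ℂ (Set.range (ann (X := X))) : Set (CAR X)) := by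
    have hi : Topology.IsInducing (CAR.toOp X) := Topology.IsInducing.subtypeVal
    rw [hi.closure_eq_preimage_closure_image]
    have e : (CAR.toOp X) '' (StarAlgebra.adjoin ℂ (Set.range (ann (X := X))) : Set (CAR X)) =
        (StarAlgebra.adjoin ℂ (Set.range (annihilation (X := X))) : Set _) := by
      have := StarAlgHom.map_adjoin (CAR.toOp X) (Set.range (ann (X := X)))
      rw [← Set.range_comp] at this
      exact congrArg SetLike.coe this
    rw [e]
    exact A.2
  exact closure_minimal h1 hc h2

theorem prod_mem_closure_shortWords {T : Set (OneParticle X)}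
    (hT : (Submodule.span ℂ T).topologicalClosure = ⊤) (l : List (CAR X))
    (h : ∀ B ∈ l, B ∈ letters Set.univ) :
    l.prod ∈ closure (shortWords T (l.length + 1) : Set (CAR X)) := by
  have hL : ∀ x ∈ letters (Set.univ : Set (OneParticle X)),
      x ∈ closure (shortWords T 2 : Set (CAR X)) := by
    have h1 : ∀ g ∈ Submodule.span ℂ T, ann g ∈ shortWords T 2 ∧ cre g ∈ shortWords T 2 := by
      intro g hg
      induction hg using Submodule.span_induction with
      | mem g hg =>
        exact ⟨Submodule.subset_span ⟨[ann g], rfl, by simpa using ann_mem_letters hg, by simp⟩,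
          Submodule.subset_span ⟨[cre g], rfl, by simpa using cre_mem_letters hg, by simp⟩⟩
      | zero =>
        rw [← star_ann, ← annL_apply, map_zero, star_zero]; exact ⟨zero_mem _, zero_mem _⟩
      | add a b _ _ ha hb =>
        rw [← star_ann, ann_add, star_add]; exact ⟨add_mem ha.1 hb.1, add_mem ha.2 hb.2⟩
      | smul c a _ ha =>
        rw [← star_ann, ann_smul, star_smul]
        exact ⟨Submodule.smul_mem _ _ ha.1, Submodule.smul_mem _ _ ha.2⟩
    rintro _ (⟨f, -, rfl⟩ | ⟨f, -, rfl⟩)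
    · have hf : f ∈ closure (Submodule.span ℂ T : Set (OneParticle X)) := by
        rw [← Submodule.topologicalClosure_coe, hT]; trivial
      exact map_mem_closure (annL X).continuous hf fun g hg => (h1 g hg).1
    · have hf : f ∈ closure (Submodule.span ℂ T : Set (OneParticle X)) := by
        rw [← Submodule.topologicalClosure_coe, hT]; trivial
      exact map_mem_closure (continuous_star.comp (annL X).continuous) hf fun g hg => (h1 g hg).2
  induction l with
  | nil => exact subset_closure (prod_mem_shortWords (by simp))
  | cons x l ih =>
    rw [List.prod_cons]
    refine map_mem_closure₂ continuous_mul (hL x (h x (by simp)))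
      (ih fun B hB => h B (by simp [hB])) fun a ha b hb => ?_
    -- products of words of length one and words of the length of `l`
    induction ha using Submodule.span_induction with
    | mem a ha =>
      obtain ⟨m, hm, hm', rfl⟩ := ha
      have := prod_mul_mem_shortWords hb hm'
      have e : m.length = 1 := by omega
      rw [e, add_comm] at this
      exact this
    | zero => rw [zero_mul]; exact zero_mem _
    | add a b _ _ ha hb => rw [add_mul]; exact add_mem ha hb
    | smul c a _ ha => rw [smul_mul_assoc]; exact Submodule.smul_mem _ c ha

/-- The even CAR algebra is generated by the even words over any total set of vectors. -/
theorem mem_closure_span_evenMonomials {T : Set (OneParticle X)}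
    (hT : (Submodule.span ℂ T).topologicalClosure = ⊤) {A : CAR X}
    (hA : A ∈ evenCAR (Set.univ : Set (OneParticle X))) :
    A ∈ closure (Submodule.span ℂ (evenMonomials T) : Set (CAR X)) := by
  rw [mem_evenCAR_iff] at hA
  have h : Submodule.span ℂ (evenMonomials Set.univ) ≤
      (Submodule.span ℂ (evenMonomials T)).topologicalClosure := by
    rw [Submodule.span_le]
    rintro _ ⟨l, hl, hl', rfl⟩
    refine closure_mono ?_ (prod_mem_closure_shortWords hT l hl')
    refine Submodule.span_mono ?_
    rintro _ ⟨m, hm, hm', rfl⟩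
    exact even_prod_mem (by rwa [Nat.succ_injective hm]) hm'
  exact closure_minimal h (Submodule.isClosed_topologicalClosure _) hA

end Words

section Modes

variable {X : Type*} [MeasureSpace X] [SigmaFinite (volume : Measure X)] {M : ℕ∞}
  {e : {n : ℕ // (n : ℕ∞) < M} → OneParticle X}

/-! ### The averages over finitely many modes -/

theorem modeKraus_of_lt {n : ℕ} (h : (n : ℕ∞) < M) : modeKraus e n = kraus (e ⟨n, h⟩) := by
  funext α
  simp only [modeKraus, dif_pos h]

theorem modeKraus_of_not_lt {n : ℕ} (h : ¬(n : ℕ∞) < M) (α : Fin 4) : modeKraus e n α = 1 := by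
  simp only [modeKraus, dif_neg h]

theorem modeKraus_mem_unitary (he : Orthonormal ℂ e) (n : ℕ) (α : Fin 4) :
    modeKraus e n α ∈ unitary (CAR X) := by
  by_cases h : (n : ℕ∞) < M
  · rw [modeKraus_of_lt h]; exact kraus_mem_unitary (he.1 _) α
  · rw [modeKraus_of_not_lt h]; exact one_mem _

theorem average_modeKraus_of_not_lt {n : ℕ} (h : ¬(n : ℕ∞) < M) (A : CAR X) :
    average (modeKraus e n) A = A :=
  average_eq_self (fun α => by rw [modeKraus_of_not_lt h]; exact one_mem _)
    fun α => by rw [modeKraus_of_not_lt h]; exact Commute.one_right A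

/-- The unitaries of a mode are even or odd polynomials in its two letters. -/
theorem kraus_commute_or_anticommute {f g : OneParticle X} (h : ⟪f, g⟫_ℂ = 0) (α β : Fin 4) :
    kraus f α * kraus g β = kraus g β * kraus f α ∨
      kraus f α * kraus g β = -(kraus g β * kraus f α) := by
  have hfg : ∀ a ∈ ({f} : Set (OneParticle X)), ∀ b ∈ ({g} : Set (OneParticle X)),
      ⟪a, b⟫_ℂ = 0 := by
    rintro _ rfl _ rfl; exact h
  have anti : ∀ x ∈ letters ({f} : Set (OneParticle X)), ∀ y ∈ letters ({g} : Set (OneParticle X)),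
      x * y = -(y * x) := fun x hx y hy => letters_anticomm hfg hx hy
  have af : ann f ∈ letters ({f} : Set (OneParticle X)) := ann_mem_letters rfl
  have cf : cre f ∈ letters ({f} : Set (OneParticle X)) := cre_mem_letters rfl
  have ag : ann g ∈ letters ({g} : Set (OneParticle X)) := ann_mem_letters rfl
  have cg : cre g ∈ letters ({g} : Set (OneParticle X)) := cre_mem_letters rfl
  have key : ∀ y : CAR X, (y * ann f = -(ann f * y) ∧ y * cre f = -(cre f * y)) →
      kraus f α * y = y * kraus f α ∨ kraus f α * y = -(y * kraus f α) := by
    rintro y ⟨h1, h2⟩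
    have h3 : Commute y (cre f * ann f) := by
      change y * (cre f * ann f) = cre f * ann f * y
      rw [← mul_assoc, h2, neg_mul, mul_assoc, h1, mul_neg, neg_neg, mul_assoc]
    fin_cases α
    · left; simp [kraus]
    · right; simp [kraus, add_mul, mul_add, h1, h2]; abel
    · right; simp [kraus, sub_mul, mul_sub, h1, h2]; abel
    · left
      exact ((Commute.one_right y).sub_right ((Commute.ofNat_right y 2).mul_right h3)).symm.eq
  have key2 : ∀ x ∈ letters ({f} : Set (OneParticle X)), Commute x (cre g * ann g) := by
    intro x hx
    change x * (cre g * ann g) = cre g * ann g * x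
    rw [← mul_assoc, anti x hx _ cg, neg_mul, mul_assoc, anti x hx _ ag, mul_neg, neg_neg,
      mul_assoc]
  fin_cases β
  · left; simp [kraus]
  · refine key _ ⟨?_, ?_⟩
    · simp [kraus, mul_add, add_mul, anti _ af _ ag, anti _ af _ cg]; abel
    · simp [kraus, mul_add, add_mul, anti _ cf _ ag, anti _ cf _ cg]; abel
  · refine key _ ⟨?_, ?_⟩
    · simp [kraus, mul_sub, sub_mul, anti _ af _ ag, anti _ af _ cg]; abel
    · simp [kraus, mul_sub, sub_mul, anti _ cf _ ag, anti _ cf _ cg]; abel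
  · left
    have h3 : ∀ x ∈ letters ({f} : Set (OneParticle X)), Commute (kraus g 3) x := fun x hx =>
      ((Commute.one_right x).sub_right ((Commute.ofNat_right x 2).mul_right (key2 x hx))).symm
    exact (commute_kraus (h3 _ af) (h3 _ cf) α).symm.eq

theorem average_modeKraus_commute (he : Orthonormal ℂ e) (m n : ℕ) :
    Commute (average (modeKraus e m)) (average (modeKraus e n)) := by
  rcases eq_or_ne m n with rfl | hmn
  · exact Commute.refl _
  refine average_commute fun α β => ?_
  by_cases hm : (m : ℕ∞) < M
  · by_cases hn : (n : ℕ∞) < M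
    · rw [modeKraus_of_lt hm, modeKraus_of_lt hn]
      exact kraus_commute_or_anticommute (he.2 fun h => hmn (Subtype.mk.inj h)) α β
    · left; rw [modeKraus_of_not_lt hn]; simp
  · left; rw [modeKraus_of_not_lt hm]; simp

/-- The maps `A ↦ E^N(A)` as bounded operators, built up one mode at a time. -/
noncomputable def condExpL (e : {n : ℕ // (n : ℕ∞) < M} → OneParticle X) :
    ℕ → CAR X →L[ℂ] CAR X
  | 0 => 1
  | N + 1 => average (modeKraus e N) * condExpL e N

theorem condExpL_succ (N : ℕ) (A : CAR X) :
    condExpL e (N + 1) A = average (modeKraus e N) (condExpL e N A) := rfl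

theorem krausProd_snoc {N : ℕ} (α : Fin N → Fin 4) (β : Fin 4) :
    krausProd e (Fin.snoc α β : Fin (N + 1) → Fin 4) = krausProd e α * modeKraus e N β := by
  rw [krausProd, List.ofFn_succ', List.prod_concat]
  simp [krausProd]

theorem condExpN_eq (N : ℕ) (A : CAR X) : condExpN e N A = condExpL e N A := by
  induction N with
  | zero =>
    simp [condExpN, condExpL, krausProd]
  | succ N ih =>
    have h : ∀ α : Fin N → Fin 4, ∀ β,
        star (krausProd e (Fin.snoc α β : Fin (N + 1) → Fin 4)) * A *
          krausProd e (Fin.snoc α β : Fin (N + 1) → Fin 4) =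
        star (modeKraus e N β) * (star (krausProd e α) * A * krausProd e α) *
          modeKraus e N β := fun α β => by
      rw [krausProd_snoc]; simp only [star_mul, mul_assoc]
    rw [condExpL_succ, ← ih, average_apply, condExpN, condExpN,
      ← (Fin.snocEquiv (fun _ : Fin (N + 1) => Fin 4)).sum_comp, Fintype.sum_prod_type]
    simp only [Fin.snocEquiv, Equiv.coe_fn_mk, h, mul_smul_comm, smul_mul_assoc, ← Finset.smul_sum,
      Finset.mul_sum, Finset.sum_mul]
    rw [smul_smul, ← mul_inv, pow_succ, mul_comm]

theorem norm_condExpL_le (he : Orthonormal ℂ e) (N : ℕ) (A : CAR X) : ‖condExpL e N A‖ ≤ ‖A‖ := by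
  induction N with
  | zero => exact le_rfl
  | succ N ih =>
    rw [condExpL_succ]
    exact (norm_average_le (modeKraus_mem_unitary he N) _).trans ih

theorem condExpL_commute (he : Orthonormal ℂ e) (n N : ℕ) :
    Commute (average (modeKraus e n)) (condExpL e N) := by
  induction N with
  | zero => exact Commute.one_right _
  | succ N ih => exact (average_modeKraus_commute he n N).mul_right ih

/-- The operators commuting with all modes. -/
def modeCommutant (e : {n : ℕ // (n : ℕ∞) < M} → OneParticle X) : Set (CAR X) :=
  {A | ∀ n, Commute A (ann (e n)) ∧ Commute A (cre (e n))}

theorem condExpL_eq_self (he : Orthonormal ℂ e) {A : CAR X} (hA : A ∈ modeCommutant e) (N : ℕ) :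
    condExpL e N A = A := by
  induction N with
  | zero => rfl
  | succ N ih =>
    rw [condExpL_succ, ih]
    by_cases h : (N : ℕ∞) < M
    · rw [modeKraus_of_lt h]
      exact average_kraus_eq_self (he.1 _) (hA ⟨N, h⟩).1 (hA ⟨N, h⟩).2
    · exact average_modeKraus_of_not_lt h A

theorem average_idem (he : Orthonormal ℂ e) (n : {n : ℕ // (n : ℕ∞) < M}) :
    average (modeKraus e n) * average (modeKraus e n) = average (modeKraus e n) := by
  refine ContinuousLinearMap.ext fun A => ?_
  rw [mul_apply_eq_comp, modeKraus_of_lt n.2]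
  exact average_kraus_eq_self (he.1 _) (average_kraus_commute_ann (he.1 _) A)
    (average_kraus_commute_cre (he.1 _) A)

theorem average_mul_condExpL (he : Orthonormal ℂ e) (n : {n : ℕ // (n : ℕ∞) < M}) {N : ℕ}
    (hN : n < N) : average (modeKraus e n) * condExpL e N = condExpL e N := by
  induction N with
  | zero => simp at hN
  | succ N ih =>
    change _ * (average (modeKraus e N) * condExpL e N) = average (modeKraus e N) * condExpL e N
    rcases (Nat.lt_succ_iff_lt_or_eq.1 hN) with h | h
    · rw [← mul_assoc, (average_modeKraus_commute he n N).eq, mul_assoc, ih h]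
    · rw [← h, ← mul_assoc, average_idem he]

theorem condExpL_average (he : Orthonormal ℂ e) (n : {n : ℕ // (n : ℕ∞) < M}) {N : ℕ}
    (hN : n < N) (A : CAR X) : condExpL e N (average (kraus (e n)) A) = condExpL e N A := by
  have h := average_mul_condExpL he n hN
  rw [(condExpL_commute he n N).eq, modeKraus_of_lt n.2] at h
  exact DFunLike.congr_fun h A

/-! ### Existence of the limit -/

/-- A word involves only finitely many modes. -/
theorem exists_finset_modes {S : Set (OneParticle X)} (l : List (CAR X))
    (h : ∀ B ∈ l, B ∈ letters (S ∪ Set.range e)) :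
    ∃ s : Finset {n : ℕ // (n : ℕ∞) < M}, ∀ B ∈ l, B ∈ letters (S ∪ e '' s) := by
  classical
  induction l with
  | nil => exact ⟨∅, by simp⟩
  | cons x l ih =>
    obtain ⟨s, hs⟩ := ih fun B hB => h B (by simp [hB])
    have hx : ∃ t : Finset {n : ℕ // (n : ℕ∞) < M}, x ∈ letters (S ∪ e '' t) := by
      rcases h x (by simp) with ⟨f, hf | ⟨n, rfl⟩, rfl⟩ | ⟨f, hf | ⟨n, rfl⟩, rfl⟩
      · exact ⟨∅, ann_mem_letters (Or.inl hf)⟩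
      · exact ⟨{n}, ann_mem_letters (Or.inr ⟨n, by simp, rfl⟩)⟩
      · exact ⟨∅, cre_mem_letters (Or.inl hf)⟩
      · exact ⟨{n}, cre_mem_letters (Or.inr ⟨n, by simp, rfl⟩)⟩
    obtain ⟨t, ht⟩ := hx
    have m1 : S ∪ e '' (t : Set _) ⊆ S ∪ e '' ((t ∪ s : Finset _) : Set _) :=
      Set.union_subset_union_right _ (Set.image_mono (by simp))
    have m2 : S ∪ e '' (s : Set _) ⊆ S ∪ e '' ((t ∪ s : Finset _) : Set _) :=
      Set.union_subset_union_right _ (Set.image_mono (by simp))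
    refine ⟨t ∪ s, fun B hB => ?_⟩
    rcases List.mem_cons.1 hB with rfl | hB
    · exact letters_mono m1 ht
    · exact letters_mono m2 (hs B hB)

/-- Averaging over a mode orthogonal to all letters fixes even words and kills odd ones. -/
theorem average_kraus_word {T : Set (OneParticle X)} {h : OneParticle X} (hh : ‖h‖ = 1)
    (hT : ∀ f ∈ T, ⟪h, f⟫_ℂ = 0) (l : List (CAR X)) (hl : ∀ B ∈ l, B ∈ letters T) :
    average (kraus h) l.prod = if Even l.length then l.prod else 0 := by
  have hx : ∀ x ∈ letters ({h} : Set (OneParticle X)),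
      x * l.prod = (-1 : ℂ) ^ l.length • (l.prod * x) := fun x hx =>
    mul_prod_of_anticomm l fun y hy =>
      letters_anticomm (by rintro _ rfl g hg; exact hT g hg) hx (hl y hy)
  have h1 := hx _ (ann_mem_letters rfl)
  have h2 := hx _ (cre_mem_letters rfl)
  split_ifs with hev
  · rw [hev.neg_one_pow, one_smul] at h1 h2
    exact average_kraus_eq_self hh h1.symm h2.symm
  · rw [(Nat.not_even_iff_odd.1 hev).neg_one_pow, neg_one_smul] at h1 h2
    exact average_kraus_eq_zero hh (by rw [h1, neg_neg]) (by rw [h2, neg_neg])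

theorem even_word_mem_modeCommutant {T : Set (OneParticle X)}
    (hT : ∀ n, ∀ f ∈ T, ⟪e n, f⟫_ℂ = 0) {A : CAR X} (hA : A ∈ evenMonomials T) :
    A ∈ modeCommutant e := by
  obtain ⟨l, hev, hl, rfl⟩ := hA
  intro n
  have hx : ∀ x ∈ letters ({e n} : Set (OneParticle X)), x * l.prod = l.prod * x := by
    intro x hx
    rw [mul_prod_of_anticomm l fun y hy =>
      letters_anticomm (by rintro _ rfl g hg; exact hT n g hg) hx (hl y hy), hev.neg_one_pow,
      one_smul]
  exact ⟨(hx _ (ann_mem_letters rfl)).symm, (hx _ (cre_mem_letters rfl)).symm⟩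

/-- Each mode orthogonal to all letters of a word leaves the average as it is if the word is even,
and makes it zero if the word is odd. So the averages are constant after at most one such mode. -/
theorem exists_condExpL_word_const (he : Orthonormal ℂ e) {S : Set (OneParticle X)}
    (hS : ∀ n, ∀ f ∈ S, ⟪e n, f⟫_ℂ = 0) (l : List (CAR X))
    (hl : ∀ B ∈ l, B ∈ letters (S ∪ Set.range e)) :
    ∃ N₀, ∀ N, N₀ ≤ N → condExpL e N l.prod = condExpL e N₀ l.prod := by
  obtain ⟨s, hs⟩ := exists_finset_modes l hl
  obtain ⟨N₀, hN₀⟩ : ∃ N₀ : ℕ, ∀ n ∈ s, (n : ℕ) < N₀ :=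
    ⟨s.sup fun n => (n : ℕ) + 1, fun n hn =>
      Finset.le_sup (f := fun n : {n : ℕ // (n : ℕ∞) < M} => (n : ℕ) + 1) hn⟩
  have hstep : ∀ N, N₀ ≤ N → ∀ h : (N : ℕ∞) < M,
      condExpL e (N + 1) l.prod = condExpL e N (if Even l.length then l.prod else 0) := by
    intro N hN h
    rw [condExpL_succ, ← mul_apply_eq_comp, (condExpL_commute he N N).eq, mul_apply_eq_comp,
      modeKraus_of_lt h, average_kraus_word (he.1 _) ?_ l hs]
    rintro f (hf | ⟨n, hn, rfl⟩)
    · exact hS _ f hf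
    · refine he.2 fun h' => ?_
      have := hN₀ n hn
      rw [← h'] at this
      exact absurd hN (not_le.2 this)
  by_cases hM : (N₀ : ℕ∞) < M
  · refine ⟨N₀ + 1, fun N hN => ?_⟩
    induction N, hN using Nat.le_induction with
    | base => rfl
    | succ N hN ih =>
      by_cases h : (N : ℕ∞) < M
      · rw [← ih, hstep N (by omega) h]
        split_ifs with hev
        · rfl
        · rw [ih, hstep N₀ le_rfl hM, if_neg hev, map_zero, map_zero]
      · rw [condExpL_succ, average_modeKraus_of_not_lt h, ih]
  · refine ⟨N₀, fun N hN => ?_⟩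
    induction N, hN using Nat.le_induction with
    | base => rfl
    | succ N hN ih =>
      have h : ¬(N : ℕ∞) < M := fun h => hM (lt_of_le_of_lt (by exact_mod_cast hN) h)
      rw [condExpL_succ, average_modeKraus_of_not_lt h, ih]

/-- Convergence on words extends to the CAR algebra, since the averages are contractions. -/
theorem cauchySeq_condExpL (he : Orthonormal ℂ e) {S : Set (OneParticle X)}
    (hS : ∀ n, ∀ f ∈ S, ⟪e n, f⟫_ℂ = 0)
    (hT : (Submodule.span ℂ (S ∪ Set.range e)).topologicalClosure = ⊤) (A : CAR X) :
    CauchySeq fun N => condExpL e N A := by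
  have hA := mem_subCAR_iff.1 (mem_subCAR_of_total hT A)
  rw [Metric.cauchySeq_iff']
  intro ε hε
  obtain ⟨B, hB, hAB⟩ := Metric.mem_closure_iff.1 hA (ε / 3) (by positivity)
  have hconst : ∃ N₀, ∀ N, N₀ ≤ N → condExpL e N B = condExpL e N₀ B := by
    clear hAB
    induction hB using Submodule.span_induction with
    | mem B hB =>
      obtain ⟨l, hl, rfl⟩ := hB
      exact exists_condExpL_word_const he hS l hl
    | zero => exact ⟨0, fun N _ => by rw [map_zero, map_zero]⟩
    | add a b _ _ ha hb =>
      obtain ⟨m, hm⟩ := ha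
      obtain ⟨n, hn⟩ := hb
      refine ⟨max m n, fun N hN => ?_⟩
      rw [map_add, map_add, hm N (le_of_max_le_left hN), hn N (le_of_max_le_right hN),
        hm _ (le_max_left m n), hn _ (le_max_right m n)]
    | smul c a _ ha =>
      obtain ⟨m, hm⟩ := ha
      exact ⟨m, fun N hN => by rw [map_smul, map_smul, hm N hN]⟩
  obtain ⟨N₀, hN₀⟩ := hconst
  refine ⟨N₀, fun N hN => ?_⟩
  have h1 : ∀ n, dist (condExpL e n A) (condExpL e n B) < ε / 3 := fun n => by
    rw [dist_eq_norm, ← map_sub]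
    exact (norm_condExpL_le he n _).trans_lt (by rwa [← dist_eq_norm])
  calc dist (condExpL e N A) (condExpL e N₀ A)
      ≤ dist (condExpL e N A) (condExpL e N B) + dist (condExpL e N B) (condExpL e N₀ B) +
          dist (condExpL e N₀ B) (condExpL e N₀ A) := dist_triangle4 _ _ _ _
    _ < ε := by
      have h2 := h1 N
      rw [hN₀ N hN] at h2 ⊢
      rw [dist_self, dist_comm (condExpL e N₀ B) (condExpL e N₀ A)]
      linarith [h1 N₀]

open Filter Topology in
/-- The limit of the averages over finitely many modes exists pointwise and is a bounded operator, if
the modes and a set of vectors orthogonal to them are total. -/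
theorem exists_condExp (he : Orthonormal ℂ e) {S : Set (OneParticle X)}
    (hS : ∀ n, ∀ f ∈ S, ⟪e n, f⟫_ℂ = 0)
    (hT : (Submodule.span ℂ (S ∪ Set.range e)).topologicalClosure = ⊤) :
    ∃ E : CAR X →L[ℂ] CAR X, ∀ A, Tendsto (fun N => condExpL e N A) atTop (𝓝 (E A)) := by
  choose F hF using fun A => cauchySeq_tendsto_of_complete (cauchySeq_condExpL he hS hT A)
  exact ⟨continuousLinearMapOfTendsto (f := F) (fun N => condExpL e N) (tendsto_pi_nhds.2 hF), hF⟩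

end Modes

section CondExp

open Filter Topology

variable {X : Type*} [MeasureSpace X] [SigmaFinite (volume : Measure X)] {M : ℕ∞}
  {e : {n : ℕ // (n : ℕ∞) < M} → OneParticle X} {E : CAR X →L[ℂ] CAR X}

/-! ### Properties of the limit -/

theorem norm_condExp_le (he : Orthonormal ℂ e)
    (hE : ∀ A, Tendsto (fun N => condExpL e N A) atTop (𝓝 (E A))) (A : CAR X) : ‖E A‖ ≤ ‖A‖ :=
  le_of_tendsto (hE A).norm (Eventually.of_forall fun N => norm_condExpL_le he N A)

theorem condExp_eq_self (he : Orthonormal ℂ e)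
    (hE : ∀ A, Tendsto (fun N => condExpL e N A) atTop (𝓝 (E A))) {A : CAR X}
    (hA : A ∈ modeCommutant e) : E A = A := by
  refine tendsto_nhds_unique (hE A) ?_
  simp only [condExpL_eq_self he hA]
  exact tendsto_const_nhds

theorem one_mem_modeCommutant : (1 : CAR X) ∈ modeCommutant e :=
  fun _ => ⟨Commute.one_left _, Commute.one_left _⟩

theorem norm_condExp (he : Orthonormal ℂ e)
    (hE : ∀ A, Tendsto (fun N => condExpL e N A) atTop (𝓝 (E A))) : ‖E‖ = 1 := by
  refine le_antisymm (E.opNorm_le_bound zero_le_one fun A => ?_) ?_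
  · rw [one_mul]; exact norm_condExp_le he hE A
  · have h := E.le_opNorm 1
    rwa [condExp_eq_self he hE one_mem_modeCommutant, norm_one, mul_one] at h

theorem condExp_average (he : Orthonormal ℂ e)
    (hE : ∀ A, Tendsto (fun N => condExpL e N A) atTop (𝓝 (E A)))
    (n : {n : ℕ // (n : ℕ∞) < M}) (A : CAR X) : E (average (kraus (e n)) A) = E A := by
  refine tendsto_nhds_unique (hE _) ((hE A).congr' ?_)
  filter_upwards [eventually_gt_atTop (n : ℕ)] with N hN
  rw [condExpL_average he n hN]

theorem average_condExp (he : Orthonormal ℂ e)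
    (hE : ∀ A, Tendsto (fun N => condExpL e N A) atTop (𝓝 (E A)))
    (n : {n : ℕ // (n : ℕ∞) < M}) (A : CAR X) : average (kraus (e n)) (E A) = E A := by
  refine tendsto_nhds_unique (((average (kraus (e n))).continuous.tendsto _).comp (hE A))
    ((hE A).congr' ?_)
  filter_upwards [eventually_gt_atTop (n : ℕ)] with N hN
  have h := DFunLike.congr_fun (average_mul_condExpL he n hN) A
  rw [modeKraus_of_lt n.2] at h
  exact h.symm

theorem condExp_mem_modeCommutant (he : Orthonormal ℂ e)
    (hE : ∀ A, Tendsto (fun N => condExpL e N A) atTop (𝓝 (E A))) (A : CAR X) :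
    E A ∈ modeCommutant e := by
  intro n
  rw [← average_condExp he hE n A]
  exact ⟨average_kraus_commute_ann (he.1 n) _, average_kraus_commute_cre (he.1 n) _⟩

/-- The limit is tracial with respect to the modes. -/
theorem condExp_letter_mul (he : Orthonormal ℂ e)
    (hE : ∀ A, Tendsto (fun N => condExpL e N A) atTop (𝓝 (E A))) {x : CAR X}
    (hx : x ∈ letters (Set.range e)) (A : CAR X) : E (x * A) = E (A * x) := by
  rcases hx with ⟨_, ⟨n, rfl⟩, rfl⟩ | ⟨_, ⟨n, rfl⟩, rfl⟩
  · rw [← condExp_average he hE n, average_kraus_ann_mul (he.1 n), condExp_average he hE]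
  · rw [← condExp_average he hE n, average_kraus_cre_mul (he.1 n), condExp_average he hE]

/-- On an even word `p x q` with a letter `x` of a mode, moving `x` to the left and to the right end
gives opposite signs, and the results have the same image by traciality. So the image of `p x q` is
that of a combination of words with two letters less. -/
theorem condExp_even_word (he : Orthonormal ℂ e)
    (hE : ∀ A, Tendsto (fun N => condExpL e N A) atTop (𝓝 (E A))) {S : Set (OneParticle X)}
    (hS : ∀ n, ∀ f ∈ S, ⟪e n, f⟫_ℂ = 0) (l : List (CAR X)) (hev : Even l.length)
    (hl : ∀ B ∈ l, B ∈ letters (S ∪ Set.range e)) :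
    E l.prod ∈ Submodule.span ℂ (evenMonomials S) := by
  induction hn : l.length using Nat.strong_induction_on generalizing l with
  | _ n ih =>
  subst hn
  by_cases hall : ∀ B ∈ l, B ∈ letters S
  · have hmem := even_prod_mem hev hall
    rw [condExp_eq_self he hE (even_word_mem_modeCommutant hS hmem)]
    exact Submodule.subset_span hmem
  push Not at hall
  obtain ⟨x, hxl, hxS⟩ := hall
  have hxT := hl x hxl
  have hxe : x ∈ letters (Set.range e) := by
    rw [letters_union] at hxT
    exact hxT.resolve_left hxS
  obtain ⟨p, q, rfl⟩ := List.append_of_mem hxl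
  have hp : ∀ B ∈ p, B ∈ letters (S ∪ Set.range e) := fun B hB => hl B (by simp [hB])
  have hq : ∀ B ∈ q, B ∈ letters (S ∪ Set.range e) := fun B hB => hl B (by simp [hB])
  obtain ⟨r, hr, er⟩ := exists_mul_prod_eq hxT p hp
  obtain ⟨r', hr', er'⟩ := exists_mul_prod_eq hxT q hq
  have hlen : (p ++ x :: q).length = p.length + q.length + 1 := by simp; ring
  rw [hlen] at hev
  have hshort : ∀ r ∈ shortWords (S ∪ Set.range e) (p.length + q.length),
      E r ∈ Submodule.span ℂ (evenMonomials S) := by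
    intro r hr
    refine (Submodule.span_le (p := (Submodule.span ℂ (evenMonomials S)).comap E.toLinearMap)).2
      ?_ hr
    rintro _ ⟨m, hm, hm', rfl⟩
    refine ih m.length (by omega) m ?_ hm' rfl
    rw [← hm] at hev
    obtain ⟨k, hk⟩ := hev
    exact ⟨k - 1, by omega⟩
  have h1 := hshort _ (mul_prod_mem_shortWords hr hq)
  have h2 := hshort _ (prod_mul_mem_shortWords hr' hp)
  have hsq : (-1 : ℂ) ^ p.length * (-1) ^ p.length = 1 := by
    rw [← mul_pow]; norm_num
  have hsign : (-1 : ℂ) ^ q.length = -(-1) ^ p.length := by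
    have hodd : (-1 : ℂ) ^ (p.length + q.length + 1) = 1 := hev.neg_one_pow
    rw [pow_succ, pow_add] at hodd
    linear_combination (-(-1 : ℂ) ^ p.length) * hodd - (-1 : ℂ) ^ q.length * hsq
  have htr := condExp_letter_mul he hE hxe (p.prod * q.prod)
  have hx1 : x * (p.prod * q.prod) =
      (-1 : ℂ) ^ p.length • (p.prod * (x * q.prod)) + r * q.prod := by
    rw [← mul_assoc, er, add_mul, smul_mul_assoc, mul_assoc]
  have hx2 : p.prod * q.prod * x =
      -(-1 : ℂ) ^ p.length • (p.prod * (x * q.prod)) + (-1 : ℂ) ^ p.length • (p.prod * r') := by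
    rw [er', hsign, mul_add, mul_smul_comm, smul_add, smul_smul, mul_assoc]
    simp only [neg_mul_neg, hsq, one_smul]
    rw [neg_smul]
    abel
  rw [hx1, hx2, map_add, map_add, map_smul, map_smul, map_smul] at htr
  have hfin : E (p.prod * (x * q.prod)) = (2 : ℂ)⁻¹ •
      (E (p.prod * r') - (-1 : ℂ) ^ p.length • E (r * q.prod)) := by
    have h3 : (2 : ℂ) • ((-1 : ℂ) ^ p.length • E (p.prod * (x * q.prod))) =
        (-1 : ℂ) ^ p.length • E (p.prod * r') - E (r * q.prod) := by
      rw [two_smul, eq_sub_iff_add_eq, add_assoc, htr, neg_smul]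
      abel
    have h4 := congrArg (fun B => (2 : ℂ)⁻¹ • (-1 : ℂ) ^ p.length • B) h3
    simp only [smul_sub, smul_smul] at h4
    rw [smul_sub, smul_smul, ← one_smul ℂ (E (p.prod * (x * q.prod)))]
    convert h4 using 2
    · linear_combination (-1 : ℂ) * hsq
    · rw [hsq, mul_one]
  rw [List.prod_append, List.prod_cons, hfin]
  exact Submodule.smul_mem _ _ (sub_mem h2 (Submodule.smul_mem _ _ h1))

theorem condExp_kraus_three_mul (he : Orthonormal ℂ e)
    (hE : ∀ A, Tendsto (fun N => condExpL e N A) atTop (𝓝 (E A)))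
    (n : {n : ℕ // (n : ℕ∞) < M}) (A : CAR X) :
    E (kraus (e n) 3 * A) = E (A * kraus (e n) 3) := by
  have h : E (cre (e n) * ann (e n) * A) = E (A * (cre (e n) * ann (e n))) := by
    rw [mul_assoc, condExp_letter_mul he hE (cre_mem_letters ⟨n, rfl⟩), mul_assoc,
      condExp_letter_mul he hE (ann_mem_letters ⟨n, rfl⟩), mul_assoc]
  change E ((1 - 2 * (cre (e n) * ann (e n))) * A) = E (A * (1 - 2 * (cre (e n) * ann (e n))))
  simp only [sub_mul, mul_sub, two_mul, add_mul, mul_add, map_sub, map_add, one_mul, mul_one, h]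

/-- For finitely many modes there is an invertible operator that implements the parity
automorphism on their words: the product of the operators `1 - 2 a†a`. -/
theorem exists_parity (he : Orthonormal ℂ e)
    (hE : ∀ A, Tendsto (fun N => condExpL e N A) atTop (𝓝 (E A)))
    (s : Finset {n : ℕ // (n : ℕ∞) < M}) :
    ∃ V W : CAR X, V * W = 1 ∧ W * V = 1 ∧ (∀ A, E (V * A) = E (A * V)) ∧
      (∀ x ∈ letters (e '' s), V * x = -(x * V)) ∧
      ∀ f, (∀ n ∈ s, ⟪e n, f⟫_ℂ = 0) → ∀ x ∈ letters {f}, V * x = x * V := by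
  classical
  induction s using Finset.induction_on with
  | empty => exact ⟨1, 1, by simp, by simp, by simp, by simp [letters], by simp⟩
  | insert k s hk ih =>
    obtain ⟨V, W, h1, h2, h3, h4, h5⟩ := ih
    have hsq := kraus_three_mul_self (he.1 k)
    have hcomm : ∀ f, ⟪e k, f⟫_ℂ = 0 → ∀ x ∈ letters {f},
        kraus (e k) 3 * x = x * kraus (e k) 3 := by
      intro f hf x hx
      have ha : ∀ y ∈ letters {e k}, x * y = -(y * x) := fun y hy =>
        letters_anticomm (by rintro _ rfl _ rfl; exact inner_eq_zero_symm.1 hf) hx hy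
      have hc : Commute x (cre (e k) * ann (e k)) := by
        change x * (cre (e k) * ann (e k)) = cre (e k) * ann (e k) * x
        rw [← mul_assoc, ha _ (cre_mem_letters rfl), neg_mul, mul_assoc,
          ha _ (ann_mem_letters rfl), mul_neg, neg_neg, mul_assoc]
      exact ((Commute.one_right x).sub_right ((Commute.ofNat_right x 2).mul_right hc)).symm.eq
    have hanti : ∀ x ∈ letters {e k}, kraus (e k) 3 * x = -(x * kraus (e k) 3) := by
      rintro _ (⟨f, rfl, rfl⟩ | ⟨f, rfl, rfl⟩)
      · exact kraus_three_mul_ann (he.1 k)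
      · exact kraus_three_mul_cre (he.1 k)
    refine ⟨V * kraus (e k) 3, kraus (e k) 3 * W, ?_, ?_, fun A => ?_, fun x hx => ?_,
      fun f hf x hx => ?_⟩
    · rw [mul_assoc, ← mul_assoc _ _ W, hsq, one_mul, h1]
    · rw [mul_assoc, ← mul_assoc W, h2, one_mul, hsq]
    · rw [mul_assoc, h3, mul_assoc, condExp_kraus_three_mul he hE, mul_assoc]
    · have hsplit : (∃ n ∈ s, x ∈ letters {e n}) ∨ x ∈ letters {e k} := by
        rcases hx with ⟨_, ⟨n, hn, rfl⟩, rfl⟩ | ⟨_, ⟨n, hn, rfl⟩, rfl⟩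
        · rcases Finset.mem_insert.1 hn with rfl | hn
          · exact Or.inr (ann_mem_letters rfl)
          · exact Or.inl ⟨n, hn, ann_mem_letters rfl⟩
        · rcases Finset.mem_insert.1 hn with rfl | hn
          · exact Or.inr (cre_mem_letters rfl)
          · exact Or.inl ⟨n, hn, cre_mem_letters rfl⟩
      rcases hsplit with ⟨n, hn, hx⟩ | hx
      · have hne : k ≠ n := fun h => hk (h ▸ hn)
        rw [mul_assoc, hcomm _ (he.2 hne) x hx, ← mul_assoc, h4 x (letters_mono (by
          rintro _ rfl; exact ⟨n, hn, rfl⟩) hx), neg_mul, mul_assoc]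
      · rw [mul_assoc, hanti x hx, mul_neg, ← mul_assoc, h5 (e k) (fun n hn => he.2 (by
          rintro rfl; exact hk hn)) x hx, mul_assoc]
    · rw [mul_assoc, hcomm f (hf k (by simp)) x hx, ← mul_assoc,
        h5 f (fun n hn => hf n (by simp [hn])) x hx, mul_assoc]

/-- If `V` implements the parity of the modes in the odd word `w`, then `E(w) = E(V w V⁻¹) = -E(w)`
by traciality. -/
theorem condExp_odd_word (he : Orthonormal ℂ e)
    (hE : ∀ A, Tendsto (fun N => condExpL e N A) atTop (𝓝 (E A))) (l : List (CAR X))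
    (hodd : Odd l.length) (hl : ∀ B ∈ l, B ∈ letters (Set.range e)) : E l.prod = 0 := by
  obtain ⟨s, hs⟩ := exists_finset_modes (S := ∅) (e := e) l (by simpa using hl)
  rw [Set.empty_union] at hs
  obtain ⟨V, W, h1, h2, h3, h4, -⟩ := exists_parity he hE s
  have hV := mul_prod_of_anticomm l fun y hy => h4 y (hs y hy)
  rw [hodd.neg_one_pow, neg_one_smul] at hV
  have h5 : E l.prod = -E l.prod := by
    calc E l.prod = E (V * (l.prod * W)) := by
          rw [h3, mul_assoc, h2, mul_one]
      _ = -E l.prod := by rw [← mul_assoc, hV, neg_mul, mul_assoc, h1, mul_one, map_neg]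
  have h6 : (2 : ℂ) • E l.prod = 0 := by
    rw [two_smul]; nth_rw 1 [h5]; exact neg_add_cancel _
  exact (smul_eq_zero.1 h6).resolve_left two_ne_zero

/-- On the algebra of the modes, the limit is scalar valued. -/
theorem condExp_mem_span_one (he : Orthonormal ℂ e)
    (hE : ∀ A, Tendsto (fun N => condExpL e N A) atTop (𝓝 (E A))) {A : CAR X}
    (hA : A ∈ subCAR (Set.range e)) : ∃ c : ℂ, E A = c • 1 := by
  have hc : IsClosed (Submodule.span ℂ {(1 : CAR X)} : Set (CAR X)) :=
    Submodule.closed_of_finiteDimensional _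
  have h : Submodule.span ℂ {A : CAR X | ∃ l : List (CAR X),
      (∀ B ∈ l, B ∈ letters (Set.range e)) ∧ A = l.prod} ≤
      (Submodule.span ℂ {(1 : CAR X)}).comap E.toLinearMap := by
    rw [Submodule.span_le]
    rintro _ ⟨l, hl, rfl⟩
    change E l.prod ∈ Submodule.span ℂ {(1 : CAR X)}
    rcases Nat.even_or_odd l.length with hev | hodd
    · have h1 := condExp_even_word he hE (S := ∅) (by simp) l hev (by simpa using hl)
      refine Submodule.span_mono ?_ h1
      rintro _ ⟨m, -, hm, rfl⟩
      have hnil : m = [] :=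
        List.eq_nil_iff_forall_not_mem.2 fun B hB => by simpa [letters] using hm B hB
      simp [hnil]
    · rw [condExp_odd_word he hE l hodd hl]
      exact zero_mem _
  have := closure_minimal (t := E ⁻¹' (Submodule.span ℂ {(1 : CAR X)} : Set (CAR X))) h
    (hc.preimage E.continuous) (mem_subCAR_iff.1 hA)
  obtain ⟨c, hc⟩ := Submodule.mem_span_singleton.1 this
  exact ⟨c, hc.symm⟩

/-- The image of the even CAR algebra is the even CAR algebra over vectors orthogonal to the
modes. -/
theorem condExp_mem_evenCAR (he : Orthonormal ℂ e)
    (hE : ∀ A, Tendsto (fun N => condExpL e N A) atTop (𝓝 (E A))) {S : Set (OneParticle X)}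
    (hS : ∀ n, ∀ f ∈ S, ⟪e n, f⟫_ℂ = 0)
    (hT : (Submodule.span ℂ (S ∪ Set.range e)).topologicalClosure = ⊤) {A : CAR X}
    (hA : A ∈ evenCAR (Set.univ : Set (OneParticle X))) : E A ∈ evenCAR S := by
  rw [mem_evenCAR_iff]
  refine map_mem_closure E.continuous (mem_closure_span_evenMonomials hT hA) fun B hB => ?_
  refine (Submodule.span_le (p := (Submodule.span ℂ (evenMonomials S)).comap E.toLinearMap)).2
    ?_ hB
  rintro _ ⟨l, hev, hl, rfl⟩
  exact condExp_even_word he hE hS l hev hl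

theorem condExp_of_mem_evenCAR (he : Orthonormal ℂ e)
    (hE : ∀ A, Tendsto (fun N => condExpL e N A) atTop (𝓝 (E A))) {S : Set (OneParticle X)}
    (hS : ∀ n, ∀ f ∈ S, ⟪e n, f⟫_ℂ = 0) {A : CAR X} (hA : A ∈ evenCAR S) : E A = A := by
  have hc : IsClosed {A | E A = A} := isClosed_eq E.continuous continuous_id
  refine closure_minimal (fun B hB => ?_) hc (mem_evenCAR_iff.1 hA)
  refine LinearMap.eqOn_span (f := E.toLinearMap) (g := LinearMap.id) (fun C hC => ?_) hB
  exact condExp_eq_self he hE (even_word_mem_modeCommutant hS hC)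

end CondExp

section Trace

open Filter Topology

variable {X : Type*} [MeasureSpace X] [SigmaFinite (volume : Measure X)] {M : ℕ∞}
  {e : {n : ℕ // (n : ℕ∞) < M} → OneParticle X} {E : CAR X →L[ℂ] CAR X}

/-! ### The tracial state -/

/-- Traciality extends from the letters of the modes to the algebra they generate. -/
theorem condExp_mul_comm (he : Orthonormal ℂ e)
    (hE : ∀ A, Tendsto (fun N => condExpL e N A) atTop (𝓝 (E A))) {B : CAR X}
    (hB : B ∈ subCAR (Set.range e)) (A : CAR X) : E (B * A) = E (A * B) := by
  have hword : ∀ l : List (CAR X), (∀ B ∈ l, B ∈ letters (Set.range e)) → ∀ A,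
      E (l.prod * A) = E (A * l.prod) := by
    intro l
    induction l with
    | nil => simp
    | cons x l ih =>
      intro hl A
      rw [List.prod_cons, mul_assoc, condExp_letter_mul he hE (hl x (by simp)), mul_assoc,
        ih (fun B hB => hl B (by simp [hB])), mul_assoc]
  have hc : IsClosed {B | E (B * A) = E (A * B)} :=
    isClosed_eq (E.continuous.comp (continuous_mul_const A))
      (E.continuous.comp (continuous_const_mul A))
  refine closure_minimal (fun C hC => ?_) hc (mem_subCAR_iff.1 hB)
  change E (C * A) = E (A * C)
  induction hC using Submodule.span_induction with
  | mem C hC =>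
    obtain ⟨l, hl, rfl⟩ := hC
    exact hword l hl A
  | zero => rw [zero_mul, mul_zero]
  | add a b _ _ ha hb => rw [add_mul, mul_add, map_add, map_add, ha, hb]
  | smul c a _ ha => rw [smul_mul_assoc, mul_smul_comm, map_smul, map_smul, ha]

theorem map_condExpL_of_tracial (he : Orthonormal ℂ e) {ω : CAR X →L[ℂ] ℂ}
    (hω : ∀ A B, ω (A * B) = ω (B * A)) (N : ℕ) (A : CAR X) : ω (condExpL e N A) = ω A := by
  induction N with
  | zero => rfl
  | succ N ih =>
    have h : ∀ α, ω (star (modeKraus e N α) * condExpL e N A * modeKraus e N α) = ω A := by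
      intro α
      rw [hω, ← mul_assoc, Unitary.mul_star_self_of_mem (modeKraus_mem_unitary he N α), one_mul, ih]
    rw [condExpL_succ, average_apply, map_smul, map_sum, Finset.sum_congr rfl fun α _ => h α]
    simp

/-- On the algebra of the modes, the limit is given by any normalized trace. -/
theorem condExp_eq_of_tracial (he : Orthonormal ℂ e)
    (hE : ∀ A, Tendsto (fun N => condExpL e N A) atTop (𝓝 (E A))) {ω : CAR X →L[ℂ] ℂ}
    (hω1 : ω 1 = 1) (hω : ∀ A B, ω (A * B) = ω (B * A)) {A : CAR X}
    (hA : A ∈ subCAR (Set.range e)) : E A = ω A • 1 := by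
  obtain ⟨c, hc⟩ := condExp_mem_span_one he hE hA
  have h : ω (E A) = ω A := by
    refine tendsto_nhds_unique ((ω.continuous.tendsto _).comp (hE A)) ?_
    simp only [Function.comp_def, map_condExpL_of_tracial he hω]
    exact tendsto_const_nhds
  rw [hc, map_smul, hω1, smul_eq_mul, mul_one] at h
  rw [hc, h]

theorem mul_prod_eq_zero {x : CAR X} {l : List (CAR X)} (h : ∀ y ∈ l, x * y = -(y * x))
    (hx : x ∈ l) (hxx : x * x = 0) : x * l.prod = 0 := by
  obtain ⟨p, q, rfl⟩ := List.append_of_mem hx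
  rw [List.prod_append, List.prod_cons, ← mul_assoc,
    mul_prod_of_anticomm p fun y hy => h y (by simp [hy]), smul_mul_assoc, mul_assoc,
    ← mul_assoc x x, hxx]
  simp

theorem prod_mul_eq_zero {x : CAR X} {l : List (CAR X)} (h : ∀ y ∈ l, x * y = -(y * x))
    (hx : x ∈ l) (hxx : x * x = 0) : l.prod * x = 0 := by
  have h1 := mul_prod_of_anticomm l h
  rw [mul_prod_eq_zero h hx hxx] at h1
  exact (smul_eq_zero.1 h1.symm).resolve_left (pow_ne_zero _ (by norm_num))

variable {ι : Type*} {g : ι → OneParticle X}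

/-- Each mode contributes a factor `½`, the average of `a†a`. -/
theorem condExp_normalMonomial_self (he : Orthonormal ℂ e)
    (hE : ∀ A, Tendsto (fun N => condExpL e N A) atTop (𝓝 (E A))) (hg : Orthonormal ℂ g)
    (hge : ∀ k, ∃ n, e n = g k) (i : List ι) (hi : i.Nodup) :
    E (normalMonomial g i i) = ((1 : ℂ) / 2 ^ i.length) • 1 := by
  induction i with
  | nil =>
    simp only [normalMonomial, List.reverse_nil, List.map_nil, List.prod_nil, mul_one,
      List.length_nil, pow_zero, div_one, one_smul]
    exact condExp_eq_self he hE one_mem_modeCommutant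
  | cons k l ih =>
    obtain ⟨hk, hl⟩ := List.nodup_cons.1 hi
    have hxy : ∀ x ∈ letters {g k}, ∀ y ∈ letters (g '' {j | j ∈ l}), x * y = -(y * x) := by
      refine fun x hx y hy => letters_anticomm ?_ hx hy
      rintro _ rfl _ ⟨j, hj, rfl⟩
      exact hg.2 (by rintro rfl; exact hk hj)
    have hC : ∀ y ∈ l.reverse.map fun k => cre (g k), y ∈ letters (g '' {j | j ∈ l}) := by
      intro y hy
      obtain ⟨j, hj, rfl⟩ := List.mem_map.1 hy
      exact cre_mem_letters ⟨j, List.mem_reverse.1 hj, rfl⟩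
    have hP : ∀ y ∈ l.map fun k => ann (g k), y ∈ letters (g '' {j | j ∈ l}) := by
      intro y hy
      obtain ⟨j, hj, rfl⟩ := List.mem_map.1 hy
      exact ann_mem_letters ⟨j, hj, rfl⟩
    have hcomm : ∀ x ∈ letters {g k}, Commute (normalMonomial g l l) x := by
      intro x hx
      have h1 := mul_prod_of_anticomm _ fun y hy => hxy x hx y (hC y hy)
      have h2 := mul_prod_of_anticomm _ fun y hy => hxy x hx y (hP y hy)
      change _ * _ = _ * _
      rw [normalMonomial, ← mul_assoc x, h1, smul_mul_assoc, mul_assoc _ x, h2, mul_smul_comm,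
        smul_smul, ← mul_assoc]
      simp only [List.length_map, List.length_reverse]
      rw [← mul_pow]
      norm_num
    have hnum : cre (g k) * ann (g k) * (l.map fun k => ann (g k)).prod =
        (l.map fun k => ann (g k)).prod * (cre (g k) * ann (g k)) := by
      have h1 := mul_prod_of_anticomm _ fun y hy => hxy _ (ann_mem_letters rfl) y (hP y hy)
      have h2 := mul_prod_of_anticomm _ fun y hy => hxy _ (cre_mem_letters rfl) y (hP y hy)
      rw [mul_assoc, h1, mul_smul_comm, ← mul_assoc, h2, smul_mul_assoc, smul_smul, ← mul_pow,
        mul_assoc]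
      norm_num
    have hmon : normalMonomial g (k :: l) (k :: l) =
        normalMonomial g l l * (cre (g k) * ann (g k)) := by
      rw [normalMonomial, normalMonomial, mul_assoc _ _ (cre (g k) * ann (g k)), ← hnum]
      simp [mul_assoc]
    obtain ⟨n, hn⟩ := hge k
    rw [hmon, ← condExp_average he hE n, hn, average_kraus_mul_number (hg.1 k)
      (hcomm _ (ann_mem_letters rfl)) (hcomm _ (cre_mem_letters rfl)), map_smul, ih hl, smul_smul,
      List.length_cons, pow_succ]
    congr 1
    field_simp

theorem condExp_normalMonomial_of_ne (he : Orthonormal ℂ e)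
    (hE : ∀ A, Tendsto (fun N => condExpL e N A) atTop (𝓝 (E A))) (hg : Orthonormal ℂ g)
    (hge : ∀ k, ∃ n, e n = g k) (i j : List ι) (hij : {k | k ∈ i} ≠ {k | k ∈ j}) :
    E (normalMonomial g i j) = 0 := by
  have hletter : ∀ k, ann (g k) ∈ letters (Set.range e) ∧ cre (g k) ∈ letters (Set.range e) :=
    fun k => ⟨ann_mem_letters (hge k), cre_mem_letters (hge k)⟩
  have hcc : ∀ k, ∀ y ∈ i.reverse.map fun k => cre (g k), cre (g k) * y = -(y * cre (g k)) := by
    intro k y hy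
    obtain ⟨l, -, rfl⟩ := List.mem_map.1 hy
    exact cre_mul_cre _ _
  have haa : ∀ k, ∀ y ∈ j.map fun k => ann (g k), ann (g k) * y = -(y * ann (g k)) := by
    intro k y hy
    obtain ⟨l, -, rfl⟩ := List.mem_map.1 hy
    exact ann_mul_ann _ _
  have hac : ∀ k l, k ≠ l → ann (g k) * cre (g l) = -(cre (g l) * ann (g k)) := by
    intro k l hkl
    rw [ann_mul_cre, hg.2 hkl]
    simp
  have hone : ∀ k, ann (g k) * cre (g k) + cre (g k) * ann (g k) = 1 := fun k => by
    rw [ann_mul_cre_self (hg.1 k), sub_add_cancel]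
  -- a mode occurring on one side only: its letter annihilates the monomial from both sides
  have hex : ∃ k, (k ∈ i ∧ k ∉ j) ∨ (k ∈ j ∧ k ∉ i) := by
    by_contra! hcon
    refine hij (Set.ext fun k => ⟨fun h => (hcon k).1 h, fun h => (hcon k).2 h⟩)
  obtain ⟨k, ⟨hi, hj⟩ | ⟨hj, hi⟩⟩ := hex
  · have hmem : cre (g k) ∈ i.reverse.map fun k => cre (g k) :=
      List.mem_map.2 ⟨k, List.mem_reverse.2 hi, rfl⟩
    have h1 : cre (g k) * normalMonomial g i j = 0 := by
      rw [normalMonomial, ← mul_assoc, mul_prod_eq_zero (hcc k) hmem (cre_mul_self _), zero_mul]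
    have h2 : normalMonomial g i j * cre (g k) = 0 := by
      have h := mul_prod_of_anticomm (x := cre (g k)) (j.map fun k => ann (g k)) (by
        intro y hy
        obtain ⟨l, hl, rfl⟩ := List.mem_map.1 hy
        rw [hac l k (by rintro rfl; exact hj hl), neg_neg])
      have h' : (i.reverse.map fun k => cre (g k)).prod *
          (cre (g k) * (j.map fun k => ann (g k)).prod) = 0 := by
        rw [← mul_assoc, prod_mul_eq_zero (hcc k) hmem (cre_mul_self _), zero_mul]
      rw [h, mul_smul_comm, ← mul_assoc] at h'
      exact (smul_eq_zero.1 h').resolve_left (pow_ne_zero _ (by norm_num))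
    calc E (normalMonomial g i j)
        = E ((ann (g k) * cre (g k) + cre (g k) * ann (g k)) * normalMonomial g i j) := by
          rw [hone, one_mul]
      _ = 0 := by
          rw [add_mul, mul_assoc, h1, mul_zero, zero_add, mul_assoc,
            condExp_letter_mul he hE (hletter k).2, mul_assoc, h2, mul_zero, map_zero]
  · have hmem : ann (g k) ∈ j.map fun k => ann (g k) := List.mem_map.2 ⟨k, hj, rfl⟩
    have h1 : normalMonomial g i j * ann (g k) = 0 := by
      rw [normalMonomial, mul_assoc, prod_mul_eq_zero (haa k) hmem (ann_mul_self _), mul_zero]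
    have h2 : ann (g k) * normalMonomial g i j = 0 := by
      have h := mul_prod_of_anticomm (x := ann (g k)) (i.reverse.map fun k => cre (g k)) (by
        intro y hy
        obtain ⟨l, hl, rfl⟩ := List.mem_map.1 hy
        exact hac k l (by rintro rfl; exact hi (List.mem_reverse.1 hl)))
      rw [normalMonomial, ← mul_assoc, h, smul_mul_assoc, mul_assoc,
        mul_prod_eq_zero (haa k) hmem (ann_mul_self _), mul_zero, smul_zero]
    calc E (normalMonomial g i j)
        = E (normalMonomial g i j * (ann (g k) * cre (g k) + cre (g k) * ann (g k))) := by
          rw [hone, mul_one]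
      _ = 0 := by
          rw [mul_add, ← mul_assoc, h1, zero_mul, zero_add, ← mul_assoc,
            ← condExp_letter_mul he hE (hletter k).1, ← mul_assoc, h2, zero_mul, map_zero]

/-- The vector functional `A ↦ ⟪Ω, A Ω⟫`. -/
noncomputable def vectorFunctional (Ω : Fock X) : CAR X →L[ℂ] ℂ :=
  LinearMap.mkContinuous
    { toFun := fun A => ⟪Ω, CAR.toOp X A Ω⟫_ℂ
      map_add' := fun A B => by rw [map_add, add_apply, inner_add_right]
      map_smul' := fun c A => by
        rw [map_smul, smul_apply, inner_smul_right]; rfl }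
    (‖Ω‖ * ‖Ω‖) fun A => by
      calc ‖⟪Ω, CAR.toOp X A Ω⟫_ℂ‖ ≤ ‖Ω‖ * ‖CAR.toOp X A Ω‖ := norm_inner_le_norm _ _
        _ ≤ ‖Ω‖ * (‖A‖ * ‖Ω‖) := by
          gcongr
          exact (CAR.toOp X A).le_opNorm Ω
        _ = ‖Ω‖ * ‖Ω‖ * ‖A‖ := by ring

theorem vectorFunctional_apply (Ω : Fock X) (A : CAR X) :
    vectorFunctional Ω A = ⟪Ω, CAR.toOp X A Ω⟫_ℂ := rfl

theorem vectorFunctional_star_mul (Ω : Fock X) (A : CAR X) :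
    vectorFunctional Ω (star A * A) = ((‖CAR.toOp X A Ω‖ ^ 2 : ℝ) : ℂ) := by
  rw [vectorFunctional_apply, map_mul, map_star, ContinuousLinearMap.star_eq_adjoint,
    mul_apply_eq_comp, ContinuousLinearMap.adjoint_inner_right, inner_self_eq_norm_sq_to_K]
  norm_cast

open scoped ComplexOrder in
/-- The averages of `A* A` are sums of operators `(A u)* (A u)`. -/
theorem vectorFunctional_condExpL_nonneg (Ω : Fock X) (N : ℕ) (A : CAR X) :
    0 ≤ vectorFunctional Ω (condExpL e N (star A * A)) := by
  have h : ∀ α : Fin N → Fin 4, star (krausProd e α) * (star A * A) * krausProd e α =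
      star (A * krausProd e α) * (A * krausProd e α) := fun α => by
    simp only [star_mul, mul_assoc]
  rw [← condExpN_eq, condExpN, map_smul, map_sum]
  simp only [h, vectorFunctional_star_mul]
  refine mul_nonneg ?_ (Finset.sum_nonneg fun α _ => by
    rw [Complex.zero_le_real]; positivity)
  have : ((4 : ℂ) ^ N)⁻¹ = ((((4 : ℝ) ^ N)⁻¹ : ℝ) : ℂ) := by push_cast; rfl
  rw [this, Complex.zero_le_real]
  positivity

open scoped ComplexOrder in
/-- If the modes span the one-particle space, then the limit is `ω(·) 1` with the tracial
state `ω`. -/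
theorem existsUnique_isTracialState (he : Orthonormal ℂ e)
    (hE : ∀ A, Tendsto (fun N => condExpL e N A) atTop (𝓝 (E A)))
    (hT : (Submodule.span ℂ (Set.range e)).topologicalClosure = ⊤) (hg : Orthonormal ℂ g)
    (hge : ∀ k, ∃ n, e n = g k) : ∃! ω : CAR X →L[ℂ] ℂ, IsTracialState g ω := by
  obtain ⟨Ω, hΩ⟩ : ∃ Ω : Fock X, ‖Ω‖ = 1 := by
    have : Nontrivial (Fock X) := nontrivial_fock
    exact exists_norm_eq (Fock X) zero_le_one
  have h1 : vectorFunctional Ω 1 = 1 := by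
    rw [vectorFunctional_apply, map_one, one_apply_eq_self, inner_self_eq_norm_sq_to_K, hΩ]
    simp
  have hE1 : E 1 = 1 := condExp_eq_self he hE one_mem_modeCommutant
  refine ⟨vectorFunctional Ω ∘L E, ?_, fun ω hω => ?_⟩
  · constructor
    · change vectorFunctional Ω (E 1) = 1
      rw [hE1, h1]
    · intro A
      have h : 0 ≤ vectorFunctional Ω (E (star A * A)) :=
        ge_of_tendsto' (((vectorFunctional Ω).continuous.tendsto _).comp (hE (star A * A)))
          fun N => vectorFunctional_condExpL_nonneg Ω N A
      rw [Complex.le_def] at h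
      exact ⟨h.1, h.2.symm⟩
    · intro A B
      exact congrArg (vectorFunctional Ω) (condExp_mul_comm he hE (mem_subCAR_of_total hT A) B)
    · intro i hi
      change vectorFunctional Ω (E _) = _
      rw [condExp_normalMonomial_self he hE hg hge i hi, map_smul, h1, smul_eq_mul, mul_one]
    · intro i j hij
      change vectorFunctional Ω (E _) = _
      rw [condExp_normalMonomial_of_ne he hE hg hge i j hij, map_zero]
  · ext1 A
    change ω A = vectorFunctional Ω (E A)
    rw [condExp_eq_of_tracial he hE hω.map_one hω.tracial (mem_subCAR_of_total hT A), map_smul, h1,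
      smul_eq_mul, mul_one]

/-- A countable type can be enumerated by an initial segment of the natural numbers. -/
theorem exists_equiv_initial_segment (ι : Type*) [Countable ι] :
    ∃ M : ℕ∞, Nonempty ({n : ℕ // (n : ℕ∞) < M} ≃ ι) := by
  rcases finite_or_infinite ι with h | h
  · refine ⟨(Nat.card ι : ℕ∞), ⟨Equiv.trans ?_ (Finite.equivFin ι).symm⟩⟩
    exact (Equiv.subtypeEquivRight fun n => by simp).trans (Fin.equivSubtype).symm
  · obtain ⟨d⟩ := nonempty_denumerable ι
    exact ⟨⊤, ⟨(Equiv.subtypeUnivEquiv fun n => ENat.natCast_lt_top n).trans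
      (Denumerable.eqv ι).symm⟩⟩

theorem HilbertBasis.countable_of_separable {H : Type*} [NormedAddCommGroup H]
    [InnerProductSpace ℂ H] [TopologicalSpace.SeparableSpace H] {ι : Type*}
    (b : HilbertBasis ι ℂ H) : Countable ι := by
  have hd : ∀ i j, i ≠ j → 1 ≤ dist (b i) (b j) := by
    intro i j hij
    have h : ‖b i - b j‖ ^ 2 = 2 := by
      rw [@norm_sub_sq ℂ, b.orthonormal.2 hij, b.orthonormal.1 i, b.orthonormal.1 j]
      norm_num
    rw [dist_eq_norm]
    nlinarith [norm_nonneg (b i - b j)]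
  refine Pairwise.countable_of_isOpen_disjoint (s := fun i => Metric.ball (b i) (1 / 2)) ?_
    (fun i => Metric.isOpen_ball) fun i => ⟨b i, by simp⟩
  intro i j hij
  exact Metric.ball_disjoint_ball (by norm_num; exact hd i j hij)

end Trace

section Main

open Filter Topology

variable {X : Type*} [MeasureSpace X] [SigmaFinite (volume : Measure X)] {M : ℕ∞}
  {e : {n : ℕ // (n : ℕ∞) < M} → OneParticle X} {E : CAR X →L[ℂ] CAR X}

/-! ### Restriction to the even algebra and the tracial state of a Hilbert basis -/

theorem exists_restrict_norm_one {R : Type*} [CStarAlgebra R] [Nontrivial R] {E : R →L[ℂ] R}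
    (B C : StarSubalgebra ℂ R) (hBC : ∀ x ∈ B, E x ∈ C) (h1 : E 1 = 1) (hE : ∀ x, ‖E x‖ ≤ ‖x‖) :
    ∃ P : B →L[ℂ] C, ‖P‖ = 1 ∧ ∀ x, (P x : R) = E x := by
  let P : B →L[ℂ] C := LinearMap.mkContinuous
    { toFun := fun x => ⟨E x, hBC x x.2⟩
      map_add' := fun x y => Subtype.ext (map_add E _ _)
      map_smul' := fun c x => Subtype.ext (map_smul E c _) } 1
    fun x => by rw [one_mul]; exact hE x
  have hP : ∀ x, (P x : R) = E x := fun x => rfl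
  refine ⟨P, le_antisymm (LinearMap.mkContinuous_norm_le _ zero_le_one _) ?_, hP⟩
  have h := P.le_opNorm 1
  have e1 : ‖P 1‖ = 1 := by
    change ‖E 1‖ = 1
    rw [h1, norm_one]
  have e2 : ‖(1 : B)‖ = 1 := norm_one (α := R)
  rwa [e1, e2, mul_one] at h

theorem exists_projection_evenCAR (he : Orthonormal ℂ e)
    (hE : ∀ A, Tendsto (fun N => condExpL e N A) atTop (𝓝 (E A))) {S : Set (OneParticle X)}
    (hS : ∀ n, ∀ f ∈ S, ⟪e n, f⟫_ℂ = 0)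
    (hT : (Submodule.span ℂ (S ∪ Set.range e)).topologicalClosure = ⊤) :
    ∃ P : evenCAR (Set.univ : Set (OneParticle X)) →L[ℂ] evenCAR S,
      ‖P‖ = 1 ∧ (∀ A : evenCAR (Set.univ : Set (OneParticle X)), (P A : CAR X) = E A) ∧
      ∀ A : evenCAR (Set.univ : Set (OneParticle X)), (A : CAR X) ∈ evenCAR S →
        (P A : CAR X) = A := by
  obtain ⟨P, hP, hPE⟩ := exists_restrict_norm_one (evenCAR Set.univ) (evenCAR S)
    (fun A hA => condExp_mem_evenCAR he hE hS hT hA)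
    (condExp_eq_self he hE one_mem_modeCommutant) (norm_condExp_le he hE)
  exact ⟨P, hP, hPE, fun A hA => (hPE A).trans (condExp_of_mem_evenCAR he hE hS hA)⟩

theorem image_evenCAR (he : Orthonormal ℂ e)
    (hE : ∀ A, Tendsto (fun N => condExpL e N A) atTop (𝓝 (E A))) {S : Set (OneParticle X)}
    (hS : ∀ n, ∀ f ∈ S, ⟪e n, f⟫_ℂ = 0)
    (hT : (Submodule.span ℂ (S ∪ Set.range e)).topologicalClosure = ⊤) :
    (fun A => E A) '' {A | A ∈ evenCAR Set.univ} = {A | A ∈ evenCAR S} := by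
  ext A
  constructor
  · rintro ⟨B, hB, rfl⟩
    exact condExp_mem_evenCAR he hE hS hT hB
  · exact fun hA =>
      ⟨A, evenCAR_mono (Set.subset_univ S) hA, condExp_of_mem_evenCAR he hE hS hA⟩

/-- Averaging over all modes of a countable Hilbert basis yields the tracial state. -/
theorem existsUnique_isTracialState_of_hilbertBasis {ι : Type*} [Countable ι]
    (g : HilbertBasis ι ℂ (OneParticle X)) : ∃! ω : CAR X →L[ℂ] ℂ, IsTracialState g ω := by
  obtain ⟨M', ⟨σ⟩⟩ := exists_equiv_initial_segment ι
  have hg : Orthonormal ℂ (g ∘ σ) := g.orthonormal.comp σ σ.injective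
  have htot : (Submodule.span ℂ (Set.range (g ∘ σ))).topologicalClosure = ⊤ := by
    rw [σ.surjective.range_comp g]; exact g.dense_span
  obtain ⟨F, hF⟩ := exists_condExp (S := ∅) hg (by simp) (by rwa [Set.empty_union])
  exact existsUnique_isTracialState hg hF htot g.orthonormal fun k => ⟨σ.symm k, by simp⟩

theorem total_union_range_orthogonal {H : Type*} [NormedAddCommGroup H] [InnerProductSpace ℂ H]
    (K : Submodule ℂ H) [CompleteSpace K] {κ : Type*} (f : HilbertBasis κ ℂ Kᗮ) :
    (Submodule.span ℂ ((K : Set H) ∪ Set.range fun n => (f n : H))).topologicalClosure = ⊤ := by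
  refine eq_top_iff.2 (le_of_eq_of_le (Submodule.sup_orthogonal_of_hasOrthogonalProjection
    (K := K)).symm (sup_le ?_ fun h hh => ?_))
  · exact fun h hh => Submodule.le_topologicalClosure _ (Submodule.subset_span (Or.inl hh))
  · have hd : (⟨h, hh⟩ : Kᗮ) ∈ closure (Submodule.span ℂ (Set.range f) : Set Kᗮ) := by
      rw [← Submodule.topologicalClosure_coe, f.dense_span]; trivial
    refine map_mem_closure continuous_subtype_val hd fun x hx => ?_
    refine (Submodule.span_le (p := (Submodule.span ℂ _).comap Kᗮ.subtype)).2 ?_ hx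
    rintro _ ⟨n, rfl⟩
    exact Submodule.subset_span (Or.inr ⟨n, rfl⟩)

end Main

end FermiFock

open MeasureTheory Filter Topology FermiFock in
theorem lemma5p3 (d : ℕ)
    (K : Submodule ℂ (OneParticle (EuclideanSpace ℝ (Fin d))))
    (hK : IsClosed (K : Set (OneParticle (EuclideanSpace ℝ (Fin d)))))
    (M : ℕ∞) (f : HilbertBasis {n : ℕ // (n : ℕ∞) < M} ℂ Kᗮ)
    {ι : Type*} (g : HilbertBasis ι ℂ (OneParticle (EuclideanSpace ℝ (Fin d)))) :
    ∃ E : CAR (EuclideanSpace ℝ (Fin d)) →L[ℂ] CAR (EuclideanSpace ℝ (Fin d)),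
      (∀ A, Tendsto
        (fun N => condExpN (fun n => (f n : OneParticle (EuclideanSpace ℝ (Fin d)))) N A)
        atTop (𝓝 (E A))) ∧
      ‖E‖ = 1 ∧
      ((∃! ω : CAR (EuclideanSpace ℝ (Fin d)) →L[ℂ] ℂ, IsTracialState g ω) ∧
        ∀ ω : CAR (EuclideanSpace ℝ (Fin d)) →L[ℂ] ℂ, IsTracialState g ω →
          ∀ A ∈ subCAR (Set.range fun n => (f n : OneParticle (EuclideanSpace ℝ (Fin d)))),
            E A = ω A • 1) ∧
      E.comp E = E ∧
      (fun A => E A) '' {A | A ∈ evenCAR Set.univ} =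
        {A | A ∈ evenCAR (K : Set (OneParticle (EuclideanSpace ℝ (Fin d))))} ∧
      evenCAR (K : Set (OneParticle (EuclideanSpace ℝ (Fin d)))) ≤ evenCAR Set.univ ∧
      ∃ P : evenCAR (Set.univ : Set (OneParticle (EuclideanSpace ℝ (Fin d)))) →L[ℂ]
          evenCAR (K : Set (OneParticle (EuclideanSpace ℝ (Fin d)))),
        ‖P‖ = 1 ∧
        (∀ A : evenCAR (Set.univ : Set (OneParticle (EuclideanSpace ℝ (Fin d)))),
          (P A : CAR (EuclideanSpace ℝ (Fin d))) = E A) ∧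
        ∀ A : evenCAR (Set.univ : Set (OneParticle (EuclideanSpace ℝ (Fin d)))),
          (A : CAR (EuclideanSpace ℝ (Fin d))) ∈
              evenCAR (K : Set (OneParticle (EuclideanSpace ℝ (Fin d)))) →
            (P A : CAR (EuclideanSpace ℝ (Fin d))) = A := by
  have : CompleteSpace K := hK.completeSpace_coe
  have : Fact ((2 : ENNReal) ≠ ⊤) := ⟨by norm_num⟩
  have : Countable ι := g.countable_of_separable
  have he : Orthonormal ℂ fun n => (f n : OneParticle (EuclideanSpace ℝ (Fin d))) :=
    f.orthonormal.comp_linearIsometry Kᗮ.subtypeₗᵢ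
  have hS : ∀ n, ∀ h ∈ (K : Set (OneParticle (EuclideanSpace ℝ (Fin d)))),
      inner ℂ (f n : OneParticle (EuclideanSpace ℝ (Fin d))) h = 0 := fun n h hh =>
    Submodule.inner_left_of_mem_orthogonal hh (f n).2
  have hT := total_union_range_orthogonal K f
  obtain ⟨E, hE⟩ := exists_condExp he hS hT
  exact ⟨E, fun A => by simpa only [condExpN_eq] using hE A, norm_condExp he hE,
    ⟨existsUnique_isTracialState_of_hilbertBasis g,
      fun ω hω A hA => condExp_eq_of_tracial he hE hω.map_one hω.tracial hA⟩,
    ContinuousLinearMap.ext fun A => condExp_eq_self he hE (condExp_mem_modeCommutant he hE A),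
    image_evenCAR he hE hS hT, evenCAR_mono (Set.subset_univ _),
    exists_projection_evenCAR he hE hS hT⟩
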